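/- Let $R$ be a commutative ring, $\otimes=\otimes_R$, $(-)^*=\mathrm{Hom}_R(-,R)$. Let $H$ be a Hopf $R$-algebra with antipode $S$ such that ${}_RH$ is locally projective (for every surjection $\pi:L\to N$ of $R$-modules, every $R$-linear $g:H\to N$ and every finitely generated submodule $F\subseteq H$ there is an $R$-linear $g':H\to L$ with $\pi g'|_F=g|_F$). Let $A$ be an $R$-algebra with a weak left $H$-action (an $R$-bilinear map $(h,a)\mapsto ha$ with $h(ab)=\sum (h_1a)(h_2b)$, $h1_A=\varepsilon(h)1_A$, $1_Ha=a$), and let $\sigma:H\otimes H\to A$ be an $R$-linear map, invertible for the convolution product on $\mathrm{Hom}_R(H\otimes H,A)$ with inverse $\sigma^{-1}$, such that $A\#_\sigma H:=A\otimes H$ with $$(a\# h)(\tilde a\#\tilde h)=\sum a(h_1\tilde a)\,\sigma(h_2\otimes\tilde h_1)\# h_3\tilde h_2$$ is associative with unity $1_A\#1_H$. Let $U\subseteq H^*$ be a left $H$-module subalgebra, i.e. an $R$-submodule closed under the convolution product $\star$ and under the action $(hf)(k)=f(kh)$ (it need not contain $\varepsilon$). For a right $H$-comodule algebra $B$ let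 $B\#^{op}U:=B\otimes U$ with multiplication $(b\# f)(\tilde b\#\tilde f)=\sum b_{<0>}\tilde b\#\big((b_{<1>}\tilde f)\star f\big)$; here $H$ is a comodule algebra through $\Delta$, and $A\#_\sigma H$ through $\mathrm{id}_A\otimes\Delta$. Let $H^*$ act on $H^*$ from the right by $(f\leftharpoonup g)(h)=\sum f(h_2)\,g(S(h_1)h_3)$. Let $H^\omega\subseteq H^*$ be the set of all $f$ for which there is $\sum_i h_i\otimes f_i\in H\otimes H^*$ with $f\leftharpoonup g=\sum_i g(h_i)f_i$ for all $g\in H^*$. Since $H$ is locally projective, this element is unique; write $\omega(f)=\sum_i h_i\otimes f_i$, and put $V:=\omega^{-1}(H\otimes U)\subseteq H^\omega$. Let $J:A\otimes V\to\mathrm{Hom}_R(H,A)$, $J(a\otimes g)(k)=g(k)a$, and define $\overline\varphi,\overline\psi:H\otimes A\to\mathrm{Hom}_R(H,A)$ by $$\overline\varphi(h\otimes a)(k)=\sum (k_1a)\,\sigma(k_2\otimes h),$$ $$\overline\psi(h\otimes a)(k)=\sum\sigma^{-1}(S(k_3)\otimes k_4)\,(S(k_2)a)\,\sigma(S(k_1)\otimes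 k_5h).$$ Assume $\overline\varphi(H\otimes A)\subseteq J(A\otimes V)$ and $\overline\psi(H\otimes A)\subseteq J(A\otimes V)$. Consider $$\alpha:(A\otimes H)\otimes U\to\mathrm{Hom}_R(H,A\otimes H),\qquad \alpha(x\otimes f)(k)=f(k)x .$$ Then: 1. If $\alpha$ is injective, there is an $R$-algebra isomorphism $$(A\#_\sigma H)\#^{op}U\;\simeq\;A\otimes_R(H\#^{op}U),$$ that is, a multiplicative $R$-linear bijection, which moreover sends $(1_A\#1_H)\#\varepsilon$ to $1_A\otimes(1_H\#\varepsilon)$ if $\varepsilon\in U$. 2. $\alpha$ is injective, for example, if $R$ is Noetherian and $U\subseteq R^H$ (all functions $H\to R$) is $A$-pure, i.e. the canonical map $U\otimes A\to R^H\otimes A$ is injective. -/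

import Mathlib

open scoped TensorProduct
open WithConv

universe u v w

noncomputable section

namespace KoppinenDuality

/-! ## Modules: local projectivity, relative purity, the maps `α` -/

section Modules

variable {R : Type u} [CommRing R]

/-- `W` is locally projective (in the sense of Zimmermann-Huisgen): every linear map `g : W → N`
can be lifted along every surjection `π : L → N` on every finitely generated submodule of `W`. -/
def LocallyProjective (R : Type u) [CommRing R] (W : Type v) [AddCommGroup W] [Module R W] :
    Prop :=
  ∀ (L N : Type (max u v)) [AddCommGroup L] [Module R L] [AddCommGroup N] [Module R N]
    (π : L →ₗ[R] N), Function.Surjective π → ∀ (g : W →ₗ[R] N) (F : Submodule R W), F.FG →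
      ∃ g' : W →ₗ[R] L, ∀ x ∈ F, π (g' x) = g x

/-- The submodule `K ⊆ M` is `N`-pure: the canonical map `K ⊗ N → M ⊗ N` is injective. -/
def IsPureFor {M : Type v} [AddCommGroup M] [Module R M] (K : Submodule R M)
    (N : Type w) [AddCommGroup N] [Module R N] : Prop :=
  Function.Injective (LinearMap.rTensor N K.subtype)

/-- For a pairing `p : V × W → R` and a module `M`, the map `α_M : M ⊗ W → Hom(V, M)`,
`m ⊗ w ↦ [v ↦ p(v, w) m]`. -/
def alpha {V W : Type*} [AddCommMonoid V] [Module R V] [AddCommMonoid W] [Module R W]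
    (p : V →ₗ[R] W →ₗ[R] R) (M : Type*) [AddCommMonoid M] [Module R M] :
    M ⊗[R] W →ₗ[R] (V →ₗ[R] M) :=
  TensorProduct.lift (LinearMap.mk₂ R (fun m w => (p.flip w).smulRight m)
    (by intros; ext; simp) (fun r m w => by ext x; exact smul_comm (p x w) r m)
    (by intros; ext; simp [add_smul]) (by intros; ext; simp [mul_smul]))

@[simp] lemma alpha_tmul {V W : Type*} [AddCommMonoid V] [Module R V] [AddCommMonoid W]
    [Module R W] (p : V →ₗ[R] W →ₗ[R] R) (M : Type*) [AddCommMonoid M] [Module R M]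
    (m : M) (x : W) (y : V) : alpha p M (m ⊗ₜ x) y = p y x • m := by
  simp [alpha]

/-- The canonical pairing `(W, U)` for a submodule `U ⊆ W*`: `(x, f) ↦ f x`. -/
def subPairing {W : Type*} [AddCommGroup W] [Module R W] (U : Submodule R (Module.Dual R W)) :
    W →ₗ[R] U →ₗ[R] R :=
  LinearMap.flip U.subtype

/-- A finite (local) dual basis for finitely many elements of a locally projective module. -/
lemma LocallyProjective.exists_dual {W : Type v} [AddCommGroup W] [Module R W]
    (hW : LocallyProjective R W) (s : Finset W) :
    ∃ g : W →ₗ[R] (W →₀ R), ∀ x ∈ s, Finsupp.linearCombination R (id : W → W) (g x) = x := by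
  obtain ⟨g, hg⟩ := hW (ULift.{v} (W →₀ R)) (ULift.{u} W)
    ((ULift.moduleEquiv.symm.toLinearMap ∘ₗ Finsupp.linearCombination R (id : W → W)) ∘ₗ
      ULift.moduleEquiv.toLinearMap)
    (by
      rintro ⟨x⟩
      refine ⟨⟨Finsupp.single x 1⟩, ULift.ext _ _ ?_⟩
      change Finsupp.linearCombination R (id : W → W) (Finsupp.single x 1) = x
      simp)
    ULift.moduleEquiv.symm.toLinearMap (Submodule.span R s) ⟨s, rfl⟩
  refine ⟨ULift.moduleEquiv.toLinearMap ∘ₗ g, fun x hx => ?_⟩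
  exact congrArg ULift.down (hg x (Submodule.subset_span hx))

/-- A locally projective module `W` satisfies the `α`-condition: all maps
`α_M : M ⊗ W → Hom(W*, M)` are injective. -/
lemma LocallyProjective.alpha_injective {W : Type v} [AddCommGroup W] [Module R W]
    (hW : LocallyProjective R W) (M : Type*) [AddCommGroup M] [Module R M] :
    Function.Injective (alpha (LinearMap.id : Module.Dual R W →ₗ[R] Module.Dual R W) M) := by
  classical
  rw [injective_iff_map_eq_zero]
  intro t ht
  obtain ⟨n, m, x, rfl⟩ := TensorProduct.exists_sum_tmul_eq t
  obtain ⟨g, hg⟩ := hW.exists_dual (Finset.univ.image x)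
  have hx : ∀ i, x i = ∑ y ∈ Finset.univ.biUnion (fun j => (g (x j)).support),
      g (x i) y • y := by
    intro i
    conv_lhs => rw [← hg (x i) (Finset.mem_image_of_mem x (Finset.mem_univ i))]
    rw [Finsupp.linearCombination_apply, Finsupp.sum]
    refine Finset.sum_subset (Finset.subset_biUnion_of_mem (fun j => (g (x j)).support)
      (Finset.mem_univ i)) fun y _ hy => ?_
    simp [Finsupp.notMem_support_iff.mp hy]
  have h0 : ∀ y, ∑ i, g (x i) y • m i = 0 := by
    intro y
    have := LinearMap.congr_fun ht (Finsupp.lapply y ∘ₗ g)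
    simpa using this
  calc ∑ i, m i ⊗ₜ[R] x i
      = ∑ i, ∑ y ∈ Finset.univ.biUnion (fun j => (g (x j)).support),
          (g (x i) y • m i) ⊗ₜ[R] y := by
        refine Finset.sum_congr rfl fun i _ => ?_
        conv_lhs => rw [hx i]
        rw [TensorProduct.tmul_sum]
        simp only [TensorProduct.tmul_smul, TensorProduct.smul_tmul']
    _ = 0 := by
        rw [Finset.sum_comm]
        refine Finset.sum_eq_zero fun y _ => ?_
        rw [← TensorProduct.sum_tmul, h0, TensorProduct.zero_tmul]

end Modules

/-! ## The dual of a Hopf algebra and its left module subalgebras -/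

section Hopf

variable {R : Type u} [CommRing R] {H : Type v} [Ring H] [HopfAlgebra R H]
variable {A : Type w} [Ring A] [Algebra R A]

/-- The left regular action of `H` on `H*`: `(h f)(k) = f(k h)`. -/
def hit (h : H) (f : Module.Dual R H) : Module.Dual R H :=
  f ∘ₗ LinearMap.mulRight R h

/-- The convolution product `(f ⋆ g)(h) = ∑ f(h₁) g(h₂)` on `H*`. -/
def conv (f g : Module.Dual R H) : Module.Dual R H :=
  (toConv f * toConv g).ofConv

variable (R H) in
/-- A left `H`-module subalgebra `U` of `H*`: a submodule closed under convolution and under the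
left regular action of `H`. It is not required to contain the unity `ε` of `H*`. -/
structure LeftModuleSubalgebra extends Submodule R (Module.Dual R H) where
  conv_mem' : ∀ {f g : Module.Dual R H}, f ∈ carrier → g ∈ carrier → conv f g ∈ carrier
  hit_mem' : ∀ (h : H) {f : Module.Dual R H}, f ∈ carrier → hit h f ∈ carrier

/-- For `f, f' ∈ U`, the map `H → U`, `h ↦ (h f') ⋆ f`. -/
def hitConv (U : LeftModuleSubalgebra R H) :
    U.toSubmodule →ₗ[R] U.toSubmodule →ₗ[R] H →ₗ[R] U.toSubmodule :=
  LinearMap.mk₂ R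
    (fun f' f =>
      { toFun := fun h => ⟨conv (hit h f'.1) f.1, U.conv_mem' (U.hit_mem' h f'.2) f.2⟩
        map_add' := fun h k => Subtype.ext (by
          have : hit (h + k) f'.1 = hit h f'.1 + hit k f'.1 := by
            ext; simp [hit, mul_add]
          simp [conv, this, add_mul])
        map_smul' := fun r h => Subtype.ext (by
          have : hit (r • h) f'.1 = r • hit h f'.1 := by
            ext; simp [hit]
          simp [conv, this, smul_mul_assoc]) })
    (fun f₁ f₂ f => by
      ext h : 2
      have : hit h (f₁.1 + f₂.1) = hit h f₁.1 + hit h f₂.1 := rfl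
      simp [conv, this, add_mul])
    (fun r f' f => by
      ext h : 2
      have : hit h (r • f'.1) = r • hit h f'.1 := rfl
      simp [conv, this, smul_mul_assoc])
    (fun f' f₁ f₂ => by ext h : 2; simp [conv, mul_add])
    (fun r f' f => by ext h : 2; simp [conv, mul_smul_comm])

@[simp] lemma hitConv_coe (U : LeftModuleSubalgebra R H) (f' f : U.toSubmodule) (h : H) :
    (hitConv U f' f h : Module.Dual R H) = conv (hit h f'.1) f.1 := rfl

/-! ## The opposite smash product `B #ᵒᵖ U` -/

section SmashOp

variable {B : Type*} [NonUnitalNonAssocRing B] [Module R B] [SMulCommClass R B B]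
  [IsScalarTower R B B]

/-- `B #ᵒᵖ U := B ⊗ U` for an algebra `B` with a right `H`-coaction `ρ : B → B ⊗ H` and a left
`H`-module subalgebra `U ⊆ H*`. -/
def SmashOp (_ρ : B →ₗ[R] B ⊗[R] H) (U : LeftModuleSubalgebra R H) : Type _ :=
  B ⊗[R] U.toSubmodule

namespace SmashOp

variable (ρ : B →ₗ[R] B ⊗[R] H) (U : LeftModuleSubalgebra R H)

instance : AddCommGroup (SmashOp ρ U) := inferInstanceAs (AddCommGroup (B ⊗[R] U.toSubmodule))

instance : Module R (SmashOp ρ U) := inferInstanceAs (Module R (B ⊗[R] U.toSubmodule))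

/-- The element `b # f`. -/
def tmul (b : B) (f : U.toSubmodule) : SmashOp ρ U := (b ⊗ₜ[R] f : B ⊗[R] U.toSubmodule)

/-- The multiplication `(b # f)(b' # f') = ∑ b₀ b' # (b₁ f') ⋆ f`, where `ρ b = ∑ b₀ ⊗ b₁`. -/
def mulMap : B ⊗[R] U.toSubmodule →ₗ[R] B ⊗[R] U.toSubmodule →ₗ[R] B ⊗[R] U.toSubmodule :=
  TensorProduct.lift (LinearMap.mk₂ R
    (fun b f => TensorProduct.lift (LinearMap.mk₂ R
      (fun b' f' => TensorProduct.map ((LinearMap.mul R B).flip b') (hitConv U f' f) (ρ b))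
      (fun b₁ b₂ f' => by simp [TensorProduct.map_add_left])
      (fun r b' f' => by simp [TensorProduct.map_smul_left])
      (fun b' f₁ f₂ => by simp [TensorProduct.map_add_right])
      (fun r b' f' => by simp [TensorProduct.map_smul_right])))
    (fun b₁ b₂ f => by ext; simp)
    (fun r b f => by ext; simp)
    (fun b f₁ f₂ => by ext; simp [TensorProduct.map_add_right])
    (fun r b f => by ext; simp [TensorProduct.map_smul_right]))

instance : NonUnitalNonAssocRing (SmashOp ρ U) where
  mul x y := mulMap ρ U x y
  left_distrib x y z := map_add (mulMap ρ U x) y z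
  right_distrib x y z := LinearMap.map_add₂ (mulMap ρ U) x y z
  zero_mul x := LinearMap.map_zero₂ (mulMap ρ U) x
  mul_zero x := map_zero (mulMap ρ U x)

lemma mul_def (x y : SmashOp ρ U) : x * y = mulMap ρ U x y := rfl

lemma tmul_mul_tmul (b b' : B) (f f' : U.toSubmodule) :
    tmul ρ U b f * tmul ρ U b' f' =
      TensorProduct.map ((LinearMap.mul R B).flip b') (hitConv U f' f) (ρ b) := rfl

instance : SMulCommClass R (SmashOp ρ U) (SmashOp ρ U) where
  smul_comm r x y := (map_smul (mulMap ρ U x) r y).symm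

instance : IsScalarTower R (SmashOp ρ U) (SmashOp ρ U) where
  smul_assoc r x y := LinearMap.map_smul₂ (mulMap ρ U) r x y

end SmashOp

end SmashOp

/-! ## Crossed products -/

variable (R H A) in
/-- A weak left `H`-action on `A`, given by the induced `R`-algebra morphism
`β : A → (Hom(H, A), ⋆)`, `β a h = h a`, with `1 a = a`. -/
structure WeakAction where
  β : A →ₐ[R] WithConv (H →ₗ[R] A)
  one_act : ∀ a, β a 1 = a

/-- `act w a` is the linear map `h ↦ h a`. -/
def WeakAction.act (w : WeakAction R H A) (a : A) : H →ₗ[R] A := (w.β a).ofConv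

/-- `A #_σ H := A ⊗ H` for a weak action of `H` on `A` and a linear map `σ : H ⊗ H → A`. -/
def CrossedProduct (_w : WeakAction R H A) (_σ : H ⊗[R] H →ₗ[R] A) : Type _ := A ⊗[R] H

namespace CrossedProduct

variable (w : WeakAction R H A) (σ : H ⊗[R] H →ₗ[R] A)

instance : AddCommGroup (CrossedProduct w σ) := inferInstanceAs (AddCommGroup (A ⊗[R] H))

instance : Module R (CrossedProduct w σ) := inferInstanceAs (Module R (A ⊗[R] H))

/-- The element `a # h`. -/
def tmul (a : A) (h : H) : CrossedProduct w σ := (a ⊗ₜ[R] h : A ⊗[R] H)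

/-- The map `H ⊗ H → A ⊗ H`, `h ⊗ k ↦ ∑ σ(h₁ ⊗ k₁) ⊗ h₂ k₂`. -/
def cocycleMul : H ⊗[R] H →ₗ[R] A ⊗[R] H :=
  TensorProduct.map σ (LinearMap.mul' R H) ∘ₗ Coalgebra.comul

/-- The multiplication map `A ⊗ (A ⊗ H) → A ⊗ H`. -/
def mulLeftFactor : A ⊗[R] (A ⊗[R] H) →ₗ[R] A ⊗[R] H :=
  (LinearMap.mul' R A).rTensor H ∘ₗ (TensorProduct.assoc R A A H).symm.toLinearMap

/-- The multiplication `(a # h)(a' # k) = ∑ a (h₁ a') σ(h₂ ⊗ k₁) # h₃ k₂`. -/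
def mulMap : A ⊗[R] H →ₗ[R] A ⊗[R] H →ₗ[R] A ⊗[R] H :=
  TensorProduct.lift (LinearMap.mk₂ R
    (fun a h => TensorProduct.lift (LinearMap.mk₂ R
      (fun a' k => mulLeftFactor (TensorProduct.map (LinearMap.mul R A a ∘ₗ w.act a')
        (cocycleMul σ ∘ₗ (TensorProduct.mk R H H).flip k) (Coalgebra.comul h)))
      (fun a₁ a₂ k => by
        simp [WeakAction.act, LinearMap.comp_add, TensorProduct.map_add_left])
      (fun r a' k => by
        simp [WeakAction.act, LinearMap.comp_smul, TensorProduct.map_smul_left])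
      (fun a' k₁ k₂ => by simp [LinearMap.comp_add, TensorProduct.map_add_right])
      (fun r a' k => by simp [LinearMap.comp_smul, TensorProduct.map_smul_right])))
    (fun a₁ a₂ h => by
      ext
      simp [LinearMap.add_comp, TensorProduct.map_add_left]
      rfl)
    (fun r a h => by
      ext
      simp [LinearMap.smul_comp, TensorProduct.map_smul_left]
      rfl)
    (fun a h₁ h₂ => by ext; simp; rfl)
    (fun r a h => by ext; simp; rfl))

instance : NonUnitalNonAssocRing (CrossedProduct w σ) where
  mul x y := mulMap w σ x y
  left_distrib x y z := map_add (mulMap w σ x) y z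
  right_distrib x y z := LinearMap.map_add₂ (mulMap w σ) x y z
  zero_mul x := LinearMap.map_zero₂ (mulMap w σ) x
  mul_zero x := map_zero (mulMap w σ x)

lemma mul_def (x y : CrossedProduct w σ) : x * y = mulMap w σ x y := rfl

instance : SMulCommClass R (CrossedProduct w σ) (CrossedProduct w σ) where
  smul_comm r x y := (map_smul (mulMap w σ x) r y).symm

instance : IsScalarTower R (CrossedProduct w σ) (CrossedProduct w σ) where
  smul_assoc r x y := LinearMap.map_smul₂ (mulMap w σ) r x y

/-- The right `H`-coaction `id ⊗ Δ` on `A #_σ H`. -/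
def coaction : CrossedProduct w σ →ₗ[R] CrossedProduct w σ ⊗[R] H :=
  (TensorProduct.assoc R A H H).symm.toLinearMap ∘ₗ (Coalgebra.comul : H →ₗ[R] H ⊗[R] H).lTensor A

end CrossedProduct

/-- `A #_σ H` is a right `H`-crossed product: it is associative with unity `1 # 1`. -/
structure IsRightCrossedProduct (w : WeakAction R H A) (σ : H ⊗[R] H →ₗ[R] A) : Prop where
  one_mul : ∀ x : CrossedProduct w σ, CrossedProduct.tmul w σ 1 1 * x = x
  mul_one : ∀ x : CrossedProduct w σ, x * CrossedProduct.tmul w σ 1 1 = x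
  mul_assoc : ∀ x y z : CrossedProduct w σ, x * y * z = x * (y * z)

/-- `σ'` is the inverse of `σ` in the convolution algebra `Hom(H ⊗ H, A)`. -/
def IsConvInverse (σ σ' : H ⊗[R] H →ₗ[R] A) : Prop :=
  toConv σ * toConv σ' = 1 ∧ toConv σ' * toConv σ = 1

/-! ## The maps `φ` and `ψ` -/

variable (R H) in
/-- `h ↦ ∑ h₁ ⊗ (h₂ ⊗ h₃)`. -/
def comul₃ : H →ₗ[R] H ⊗[R] (H ⊗[R] H) :=
  (Coalgebra.comul : H →ₗ[R] H ⊗[R] H).lTensor H ∘ₗ Coalgebra.comul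

/-- `φ(h ⊗ a)(k) = ∑ (k₁ a) σ(k₂ ⊗ h)`. -/
def phi (w : WeakAction R H A) (σ : H ⊗[R] H →ₗ[R] A) : H ⊗[R] A →ₗ[R] (H →ₗ[R] A) :=
  TensorProduct.lift (LinearMap.mk₂ R
    (fun h a => LinearMap.mul' R A ∘ₗ
      TensorProduct.map (w.act a) (σ ∘ₗ (TensorProduct.mk R H H).flip h) ∘ₗ Coalgebra.comul)
    (fun h₁ h₂ a => by
      simp [LinearMap.comp_add, LinearMap.add_comp, TensorProduct.map_add_right])
    (fun r h a => by
      simp [LinearMap.comp_smul, LinearMap.smul_comp, TensorProduct.map_smul_right])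
    (fun h a₁ a₂ => by
      simp [WeakAction.act, LinearMap.comp_add, LinearMap.add_comp, TensorProduct.map_add_left])
    (fun r h a => by
      simp [WeakAction.act, LinearMap.comp_smul, LinearMap.smul_comp,
        TensorProduct.map_smul_left]))

/-- The map `k ↦ ∑ σ'(S(k₂) ⊗ k₃) (S(k₁) a)`. -/
def psiInner (w : WeakAction R H A) (σ' : H ⊗[R] H →ₗ[R] A) (a : A) : H →ₗ[R] A :=
  LinearMap.mul' R A ∘ₗ (TensorProduct.comm R A A).toLinearMap ∘ₗ
    TensorProduct.map (w.act a ∘ₗ HopfAlgebra.antipode R)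
      (σ' ∘ₗ (HopfAlgebra.antipode R).rTensor H) ∘ₗ comul₃ R H

/-- `ψ(h ⊗ a)(k) = ∑ σ'(S(k₃) ⊗ k₄) (S(k₂) a) σ(S(k₁) ⊗ k₅ h)`, where `σ'` is the convolution
inverse of `σ`; the middle factors `k₂, k₃, k₄` are collected in `psiInner`. -/
def psi (w : WeakAction R H A) (σ σ' : H ⊗[R] H →ₗ[R] A) : H ⊗[R] A →ₗ[R] (H →ₗ[R] A) :=
  TensorProduct.lift (LinearMap.mk₂ R
    (fun h a => LinearMap.mul' R A ∘ₗ
      TensorProduct.map (psiInner w σ' a)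
        (σ ∘ₗ TensorProduct.map (HopfAlgebra.antipode R) ((LinearMap.mul R H).flip h)) ∘ₗ
      (TensorProduct.leftComm R H H H).toLinearMap ∘ₗ comul₃ R H)
    (fun h₁ h₂ a => by
      simp [LinearMap.comp_add, LinearMap.add_comp,
        TensorProduct.map_add_right])
    (fun r h a => by
      simp [LinearMap.comp_smul, LinearMap.smul_comp,
        TensorProduct.map_smul_right])
    (fun h a₁ a₂ => by
      simp [psiInner, WeakAction.act, LinearMap.comp_add, LinearMap.add_comp,
        TensorProduct.map_add_left])
    (fun r h a => by
      simp [psiInner, WeakAction.act, LinearMap.comp_smul, LinearMap.smul_comp,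
        TensorProduct.map_smul_left]))

/-! ## The rational part `H^ω` of `H*` -/

/-- For a module `M`, the map `H ⊗ M → Hom(H*, M)`, `h ⊗ m ↦ [g ↦ g(h) m]`. -/
def alphaRight (R : Type u) [CommRing R] (H : Type v) [Ring H] [HopfAlgebra R H]
    (M : Type*) [AddCommGroup M] [Module R M] :
    H ⊗[R] M →ₗ[R] (Module.Dual R H →ₗ[R] M) :=
  alpha (LinearMap.id : Module.Dual R H →ₗ[R] Module.Dual R H) M ∘ₗ
    (TensorProduct.comm R H M).toLinearMap

lemma alphaRight_injective (hH : LocallyProjective R H) (M : Type*) [AddCommGroup M]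
    [Module R M] : Function.Injective (alphaRight R H M) :=
  (hH.alpha_injective M).comp (TensorProduct.comm R H M).injective

/-- For a right `H*`-module `M` with action `ρ : m ↦ [g ↦ m g]`, the `H`-rational part
`{m | ∃ ∑ hᵢ ⊗ mᵢ ∈ H ⊗ M, ∀ g ∈ H*, m g = ∑ g(hᵢ) mᵢ}` of `M`. -/
def rat {M : Type*} [AddCommGroup M] [Module R M] (ρ : M →ₗ[R] (Module.Dual R H →ₗ[R] M)) :
    Submodule R M :=
  (LinearMap.range (alphaRight R H M)).comap ρ

/-- For `H` locally projective, the structure map `Rat(M) → H ⊗ M`, `m ↦ ∑ hᵢ ⊗ mᵢ`, where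
`m g = ∑ g(hᵢ) mᵢ` for all `g ∈ H*`. -/
def ratCoaction (hH : LocallyProjective R H) {M : Type*} [AddCommGroup M] [Module R M]
    (ρ : M →ₗ[R] (Module.Dual R H →ₗ[R] M)) : rat ρ →ₗ[R] H ⊗[R] M :=
  (LinearEquiv.ofInjective (alphaRight R H M) (alphaRight_injective hH M)).symm.toLinearMap ∘ₗ
    ρ.restrict (fun _ hm => hm)

/-- `h ↦ ∑ h₂ ⊗ S(h₁) h₃`. -/
def twistedComul (R : Type u) [CommRing R] (H : Type v) [Ring H] [HopfAlgebra R H] :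
    H →ₗ[R] H ⊗[R] H :=
  (LinearMap.mul' R H ∘ₗ (HopfAlgebra.antipode R).rTensor H).lTensor H ∘ₗ
    (TensorProduct.leftComm R H H H).toLinearMap ∘ₗ comul₃ R H

/-- The twisted right action of `H*` on `H*`: `(f ↼ g)(h) = ∑ f(h₂) g(S(h₁) h₃)`. -/
def twistedAction (R : Type u) [CommRing R] (H : Type v) [Ring H] [HopfAlgebra R H] :
    Module.Dual R H →ₗ[R] (Module.Dual R H →ₗ[R] Module.Dual R H) :=
  LinearMap.mk₂ R (fun f g => LinearMap.mul' R R ∘ₗ TensorProduct.map f g ∘ₗ twistedComul R H)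
    (fun f₁ f₂ g => by ext; simp [TensorProduct.map_add_left])
    (fun r f g => by ext; simp [TensorProduct.map_smul_left])
    (fun f g₁ g₂ => by ext; simp [TensorProduct.map_add_right])
    (fun r f g => by ext; simp [TensorProduct.map_smul_right])

/-- `H^ω`, the rational part of `H*` under the twisted action. -/
def Homega (R : Type u) [CommRing R] (H : Type v) [Ring H] [HopfAlgebra R H] :
    Submodule R (Module.Dual R H) :=
  rat (twistedAction R H)

/-- The structure map `ω` of `H^ω`, with values in `H ⊗ H*` (which contains `H ⊗ H^ω` and
`H ⊗ U`, since `H` is flat). -/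
def omega (hH : LocallyProjective R H) : Homega R H →ₗ[R] H ⊗[R] Module.Dual R H :=
  ratCoaction hH (twistedAction R H)

/-- `ω⁻¹(H ⊗ U)`, as a submodule of `H*`. -/
def omegaPreimage (hH : LocallyProjective R H) (U : Submodule R (Module.Dual R H)) :
    Submodule R (Module.Dual R H) :=
  ((LinearMap.range (U.subtype.lTensor H)).comap (omega hH)).map (Homega R H).subtype

end Hopf

end KoppinenDuality

end

/-! For a comodule algebra `B`, the rule `c · (b # f) = ∑ c₀ b f(c₁)` makes `B #ᵒᵖ U` act on `B`
from the right. So `(A #_σ H) #ᵒᵖ U` acts on `A ⊗ H`, and so does `A ⊗ (H #ᵒᵖ U)`, with `A` acting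
on itself by right multiplication. Both actions commute with left multiplication by `A`, so each
operator is determined by its values on the elements `1 ⊗ k`. The isomorphism matches elements that
induce the same operator; once the two actions are faithful and have the same operators,
multiplicativity and preservation of the unit follow at once.

On the elements `1 ⊗ k` the operators are convolution products: `j ⋆ α(x)` in `Hom(H, A #_σ H)` with
`j(k) = 1 # k`, and `ι ⋆ α(y)` in `Hom(H, A ⊗ H)` with `ι(k) = 1 ⊗ k` (`toEnd_one_tmul`,
`tensorEnd_one_tmul`). The map `ι` has the convolution inverse `ι ∘ S`. The map `j` has the inverse
`k ↦ ∑ σ⁻¹(S(k₂) ⊗ k₃) # S(k₁)`, because a crossed product with invertible cocycle is cleft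
(`IsCrossed.inverse_mul`, `IsCrossed.mul_inverse`). Hence injectivity of `α` gives faithfulness on
both sides.

It remains to compare the images in `Hom(H, A ⊗ H)`. For `x = (a # h) # f` the product `j ⋆ α(x)`
equals `ι ⋆ F ⋆ f` with `F(k) = ∑ φ(h₁ ⊗ a)(k₂) ⊗ S(k₁) k₃ h₂`. For `y = (a ⊗ h) ⊗ f` the product `ι
⋆ α(y)` equals `j ⋆ G ⋆ f`, where `G` has the same form with `ψ` in place of `φ`. The twisted
expression `∑ g(k₂) S(k₁) k₃` is what `ω(g)` describes: for `g ∈ V` it is `∑ uᵢ(k) hᵢ` with `uᵢ ∈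
U`. So the hypotheses on `φ` and `ψ` put `F` and `G` in the image of `α`, and closure of `U` under
convolution absorbs `f` (`crossMap_twistedComul_mem`, `rconv_alpha_mem`). This gives the two
inclusions `range_crossedToHom_le` and `range_tensorToHom_le`.

For the second claim, `R^H ⊗ A → A^H` is injective over a Noetherian ring, so purity gives
injectivity of `α_A`. Functionals on the locally projective module `H` then lift this to `A ⊗ H`. -/

noncomputable section

namespace KoppinenDuality

/-! ### Injectivity of the maps `α`. -/

section Modules

variable {R : Type u} [CommRing R]

/-- Over a Noetherian ring the canonical map `R^X ⊗ N → N^X` is injective. -/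
lemma piScalar_tensor_injective [IsNoetherianRing R] {X N : Type*} [AddCommGroup N] [Module R N]
    (t : (X → R) ⊗[R] N)
    (ht : ∀ x, TensorProduct.lid R N ((LinearMap.proj x : (X → R) →ₗ[R] R).rTensor N t) = 0) :
    t = 0 := by
  obtain ⟨n, f, a, rfl⟩ := TensorProduct.exists_sum_tmul_eq t
  -- For each `x` the vector `(f i x)ᵢ` is a relation among the `a i`. The module of relations lies
  -- in `Rⁿ`, so one finite generating set `s` serves all `x`, and the coefficients become functions
  -- of `x`.
  obtain ⟨s, hs⟩ := IsNoetherian.noetherian (LinearMap.ker (Fintype.linearCombination R a))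
  have hmem : ∀ x, (fun i => f i x) ∈ Submodule.span R (s : Set (Fin n → R)) := by
    intro x
    rw [hs, LinearMap.mem_ker, Fintype.linearCombination_apply]
    simpa using ht x
  choose c hc using fun x => Submodule.mem_span_finset.1 (hmem x)
  have hf : ∀ i, f i = ∑ r ∈ s, r i • (fun x => c x r) := by
    intro i
    funext x
    have := congrFun (hc x).2 i
    simp only [Finset.sum_apply, Pi.smul_apply, smul_eq_mul] at this ⊢
    rw [← this]
    exact Finset.sum_congr rfl fun r _ => mul_comm _ _
  calc ∑ i, f i ⊗ₜ[R] a i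
      = ∑ i, ∑ r ∈ s, (fun x => c x r) ⊗ₜ[R] (r i • a i) := by
        refine Finset.sum_congr rfl fun i _ => ?_
        rw [hf i, TensorProduct.sum_tmul]
        simp only [TensorProduct.smul_tmul]
    _ = 0 := by
        rw [Finset.sum_comm]
        refine Finset.sum_eq_zero fun r hr => ?_
        rw [← TensorProduct.tmul_sum]
        have : r ∈ LinearMap.ker (Fintype.linearCombination R a) := by
          rw [← hs]; exact Submodule.subset_span hr
        rw [LinearMap.mem_ker, Fintype.linearCombination_apply] at this
        rw [this, TensorProduct.tmul_zero]

/-- Over a Noetherian ring, a submodule `U ⊆ W* ⊆ R^W` that is `N`-pure in `R^W` has an injective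
map `α_N`. -/
lemma alpha_injective_of_isPureFor [IsNoetherianRing R] {W N : Type*} [AddCommGroup W] [Module R W]
    [AddCommGroup N] [Module R N] (U : Submodule R (Module.Dual R W))
    (hU : IsPureFor (U.map (LinearMap.ltoFun R W R R)) N) :
    Function.Injective (alpha (subPairing U) N) := by
  rw [injective_iff_map_eq_zero]
  intro t ht
  set U' := U.map (LinearMap.ltoFun R W R R)
  have hinj : Function.Injective (LinearMap.ltoFun R W R R) := DFunLike.coe_injective
  let e : U ≃ₗ[R] U' := Submodule.equivMapOfInjective _ hinj U
  have he : ∀ (f : U) x, (e f : W → R) x = f.1 x := fun _ _ => rfl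
  let E : N ⊗[R] U ≃ₗ[R] U' ⊗[R] N :=
    TensorProduct.comm R N U ≪≫ₗ TensorProduct.congr e (LinearEquiv.refl R N)
  suffices h : U'.subtype.rTensor N (E t) = 0 by
    have := hU (h.trans (map_zero (U'.subtype.rTensor N)).symm)
    simpa using this
  refine piScalar_tensor_injective _ fun x => ?_
  have : ∀ t, TensorProduct.lid R N ((LinearMap.proj x : (W → R) →ₗ[R] R).rTensor N
      (U'.subtype.rTensor N (E t))) = alpha (subPairing U) N t x := by
    intro t
    induction t with
    | zero => simp
    | add t₁ t₂ h₁ h₂ => simp only [map_add, h₁, h₂, LinearMap.add_apply]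
    | tmul a f => simp [E, he, subPairing]
  rw [this, ht, LinearMap.zero_apply]

/-- For `W` locally projective, injectivity of `α_N` implies injectivity of `α_{N ⊗ W}`. -/
lemma LocallyProjective.alpha_tensor_injective {W : Type v} [AddCommGroup W] [Module R W]
    (hW : LocallyProjective R W) {V K N : Type*} [AddCommGroup V] [Module R V] [AddCommGroup K]
    [Module R K] [AddCommGroup N] [Module R N] (p : V →ₗ[R] K →ₗ[R] R)
    (hp : Function.Injective (alpha p N)) : Function.Injective (alpha p (N ⊗[R] W)) := by
  classical
  rw [injective_iff_map_eq_zero]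
  intro t ht
  -- `E` moves the factor `W` to the end, so that a functional on `W` can be applied to it. By `key`
  -- this commutes with `α`.
  let E := TensorProduct.comm R (N ⊗[R] W) K ≪≫ₗ (TensorProduct.assoc R K N W).symm ≪≫ₗ
    TensorProduct.congr (TensorProduct.comm R K N) (LinearEquiv.refl R W)
  have key : ∀ (g : Module.Dual R W) (s : (N ⊗[R] W) ⊗[R] K) (y : V),
      alpha p N (TensorProduct.rid R _ (g.lTensor (N ⊗[R] K) (E s))) y =
        TensorProduct.rid R N (g.lTensor N (alpha p (N ⊗[R] W) s y)) := by
    intro g s y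
    induction s with
    | zero => simp
    | add t₁ t₂ h₁ h₂ => simp only [map_add, h₁, h₂, LinearMap.add_apply]
    | tmul z f =>
      induction z with
      | zero => simp
      | add t₁ t₂ h₁ h₂ => simp only [TensorProduct.add_tmul, map_add, h₁, h₂, LinearMap.add_apply]
      | tmul n w => simpa [E] using smul_comm _ _ _
  have h0 : ∀ g : Module.Dual R W, TensorProduct.rid R _ (g.lTensor (N ⊗[R] K) (E t)) = 0 := by
    intro g
    refine hp ?_
    ext y
    rw [key, ht]
    simp
  -- An element of `(N ⊗ K) ⊗ W` killed by every functional on `W` vanishes: this is the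
  -- `α`-condition for `W`.
  have h1 : E t = 0 := by
    refine hW.alpha_injective _ ?_
    ext g
    rw [map_zero, LinearMap.zero_apply, ← h0 g]
    generalize E t = z
    induction z with
    | zero => simp
    | add t₁ t₂ h₁ h₂ => simp only [map_add, h₁, h₂, LinearMap.add_apply]
    | tmul n w => simp
  simpa using h1

end Modules

/-! ### The right action of `B #ᵒᵖ U` on `B`. -/

section

variable {R : Type u} [CommRing R] {H : Type v} [Ring H] [HopfAlgebra R H]
variable {B : Type*} [NonUnitalNonAssocRing B] [Module R B] [SMulCommClass R B B]
  [IsScalarTower R B B]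

/-- For a coaction `ρ : B → B ⊗ H` and `F : H → B`, the endomorphism `c ↦ ∑ c₀ F(c₁)` of `B`. -/
def coactionEnd (ρ : B →ₗ[R] B ⊗[R] H) : (H →ₗ[R] B) →ₗ[R] (B →ₗ[R] B) where
  toFun F := LinearMap.mul' R B ∘ₗ F.lTensor B ∘ₗ ρ
  map_add' F G := by simp [LinearMap.lTensor_add, LinearMap.comp_add, LinearMap.add_comp]
  map_smul' r F := by simp [LinearMap.lTensor_smul, LinearMap.comp_smul, LinearMap.smul_comp]

namespace SmashOp

variable (ρ : B →ₗ[R] B ⊗[R] H) (U : LeftModuleSubalgebra R H)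

/-- The map `α_B` on `B #ᵒᵖ U`. -/
def toHom : SmashOp ρ U →ₗ[R] (H →ₗ[R] B) := alpha (subPairing U.toSubmodule) B

@[simp] lemma toHom_tmul (b : B) (f : U.toSubmodule) (k : H) :
    toHom ρ U (tmul ρ U b f) k = f.1 k • b :=
  alpha_tmul (subPairing U.toSubmodule) B b f k

/-- `B #ᵒᵖ U` acts on `B` through `c · (b # f) = ∑ c₀ b f(c₁)`. -/
def toEnd : SmashOp ρ U →ₗ[R] (B →ₗ[R] B) := coactionEnd ρ ∘ₗ toHom ρ U

lemma toEnd_tmul (b : B) (f : U.toSubmodule) (c : B) :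
    toEnd ρ U (tmul ρ U b f) c = TensorProduct.rid R B (f.1.lTensor B (ρ c)) * b := by
  change LinearMap.mul' R B ((toHom ρ U (tmul ρ U b f)).lTensor B (ρ c)) = _
  hopf_tensor_induction ρ c with c₀ c₁
  simp [smul_mul_assoc]

@[elab_as_elim]
lemma induction_on {p : SmashOp ρ U → Prop} (x : SmashOp ρ U) (zero : p 0)
    (add : ∀ x y, p x → p y → p (x + y)) (tmul : ∀ b f, p (tmul ρ U b f)) : p x :=
  TensorProduct.induction_on (motive := p) x zero tmul add

/-- For an associative right `H`-comodule algebra `B`, the action of `B #ᵒᵖ U` on `B` is a right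
action. -/
lemma toEnd_mul (hB : ∀ a b c : B, a * b * c = a * (b * c))
    (hρ : ∀ c, TensorProduct.assoc R B H H (ρ.rTensor H (ρ c)) =
      (Coalgebra.comul : H →ₗ[R] H ⊗[R] H).lTensor B (ρ c))
    (hmul : ∀ a b, ρ (a * b) = ρ a * ρ b) (x y : SmashOp ρ U) (c : B) :
    toEnd ρ U (x * y) c = toEnd ρ U y (toEnd ρ U x c) := by
  induction x using induction_on with
  | zero => simp
  | add x₁ x₂ h₁ h₂ => simp only [add_mul, map_add, LinearMap.add_apply, h₁, h₂]
  | tmul b f =>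
    induction y using induction_on with
    | zero => simp
    | add x₁ x₂ h₁ h₂ => simp only [mul_add, map_add, LinearMap.add_apply, h₁, h₂]
    | tmul b' f' =>
      -- By coassociativity, `ρ(∑ c₀ f(c₁)) = ∑ c₀ ⊗ c₁ f(c₂)`.
      have h₁ : ρ (TensorProduct.rid R B (f.1.lTensor B (ρ c))) =
          (TensorProduct.rid R H ∘ₗ f.1.lTensor H ∘ₗ Coalgebra.comul).lTensor B (ρ c) := by
        rw [← LinearMap.comp_assoc, LinearMap.lTensor_comp_apply, ← hρ]
        generalize ρ c = z
        induction z with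
        | zero => simp
        | add x y hx hy => simp only [map_add, hx, hy]
        | tmul c₀ c₁ =>
          simp only [LinearMap.lTensor_tmul, TensorProduct.rid_tmul, map_smul,
            LinearMap.rTensor_tmul]
          generalize ρ c₀ = z
          induction z with
          | zero => simp
          | add x y hx hy => simp only [map_add, smul_add, TensorProduct.add_tmul, hx, hy]
          | tmul c₂ c₃ => simp
      -- Here `z` stands for `ρ b`. Both sides are `∑ c₀ b₀ b' f'(c₁ b₁) f(c₂)`, since `((b₁ f') ⋆
      -- f)(c₁) = ∑ f'(c₁ b₁) f(c₂)`. This explains the order of the factors in the opposite smash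
      -- product.
      have h₂ : ∀ z : B ⊗[R] H, (coactionEnd ρ ∘ₗ alpha (subPairing U.toSubmodule) B)
          (TensorProduct.map ((LinearMap.mul R B).flip b') (hitConv U f' f) z) c =
          TensorProduct.rid R B (f'.1.lTensor B ((TensorProduct.rid R H ∘ₗ f.1.lTensor H ∘ₗ
            Coalgebra.comul).lTensor B (ρ c) * z)) * b' := by
        intro z
        induction z with
        | zero => simp
        | add x y hx hy => simp only [map_add, LinearMap.add_apply, mul_add, add_mul, hx, hy]
        | tmul b₀ b₁ =>
          refine (toEnd_tmul ρ U (b₀ * b') (hitConv U f' f b₁) c).trans ?_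
          rw [hitConv_coe]
          generalize ρ c = z
          induction z with
          | zero => simp
          | add x y hx hy => simp only [map_add, add_mul, hx, hy]
          | tmul c₀ c₁ =>
            have h₃ : conv (hit b₁ f'.1) f.1 c₁ =
                f'.1 (TensorProduct.rid R H (f.1.lTensor H (Coalgebra.comul c₁)) * b₁) := by
              change LinearMap.mul' R R
                (TensorProduct.map (hit b₁ f'.1) f.1 (Coalgebra.comul c₁)) = _
              hopf_tensor_induction (Coalgebra.comul (R := R) c₁) with d₁ d₂
              simp [hit, mul_comm]
            simp [h₃, hB, smul_mul_assoc]
      rw [toEnd_tmul, toEnd_tmul, hmul, h₁, ← h₂]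
      rfl

end SmashOp
end

/-! ### The crossed product as a comodule algebra with a left `A`-linear structure. -/

section

variable {R : Type u} [CommRing R] {H : Type v} [Ring H] [HopfAlgebra R H]
variable {A : Type w} [Ring A] [Algebra R A]

lemma WeakAction.act_one (act : WeakAction R H A) (h : H) :
    act.act 1 h = algebraMap R A (Coalgebra.counit h) := by
  simp [WeakAction.act]

namespace CrossedProduct

variable (act : WeakAction R H A) (σ : H ⊗[R] H →ₗ[R] A)

instance : Module A (CrossedProduct act σ) := inferInstanceAs (Module A (A ⊗[R] H))

instance : IsScalarTower R A (CrossedProduct act σ) :=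
  inferInstanceAs (IsScalarTower R A (A ⊗[R] H))

instance : SMulCommClass R A (CrossedProduct act σ) :=
  inferInstanceAs (SMulCommClass R A (A ⊗[R] H))

instance : SMulCommClass A R (CrossedProduct act σ) :=
  inferInstanceAs (SMulCommClass A R (A ⊗[R] H))

variable {act σ}

@[elab_as_elim]
lemma induction_on {p : CrossedProduct act σ → Prop} (x : CrossedProduct act σ) (zero : p 0)
    (add : ∀ x y, p x → p y → p (x + y)) (tmul : ∀ a h, p (tmul act σ a h)) : p x :=
  TensorProduct.induction_on (motive := p) x zero tmul add

@[simp] lemma smul_tmul' (a b : A) (h : H) : a • tmul act σ b h = tmul act σ (a * b) h := rfl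

lemma tmul_eq_smul (a : A) (h : H) : tmul act σ a h = a • tmul act σ 1 h := by simp

@[simp] lemma mulLeftFactor_tmul (a : A) (t : A ⊗[R] H) :
    mulLeftFactor (a ⊗ₜ[R] t) = a • t := by
  induction t with
  | zero => simp
  | add x y hx hy => simp only [TensorProduct.tmul_add, map_add, hx, hy, smul_add]
  | tmul b h => simp [mulLeftFactor, TensorProduct.smul_tmul']

lemma tmul_mul_tmul (a b : A) (h k : H) :
    tmul act σ a h * tmul act σ b k =
      mulLeftFactor (TensorProduct.map (LinearMap.mul R A a ∘ₗ act.act b)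
        (cocycleMul σ ∘ₗ (TensorProduct.mk R H H).flip k) (Coalgebra.comul h)) := rfl

lemma one_tmul_mul_tmul (b : A) (h k : H) :
    tmul act σ 1 h * tmul act σ b k =
      mulLeftFactor (TensorProduct.map (act.act b)
        (cocycleMul σ ∘ₗ (TensorProduct.mk R H H).flip k) (Coalgebra.comul h)) := by
  rw [tmul_mul_tmul]
  congr 3
  ext
  simp

/-- Left `A`-linearity needs only associativity of `A`, not of the crossed product. It reduces later
computations to products with left factor `1 # h`. -/
lemma smul_mul (a : A) (x y : CrossedProduct act σ) : a • x * y = a • (x * y) := by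
  induction x using induction_on with
  | zero => simp
  | add x₁ x₂ h₁ h₂ => simp only [smul_add, add_mul, h₁, h₂]
  | tmul b h =>
    induction y using induction_on with
    | zero => simp
    | add x₁ x₂ h₁ h₂ => simp only [smul_add, mul_add, h₁, h₂]
    | tmul c k =>
      rw [smul_tmul', tmul_mul_tmul, tmul_mul_tmul]
      generalize (Coalgebra.comul h : H ⊗[R] H) = z
      change (_ : A ⊗[R] H) = a • (_ : A ⊗[R] H)
      induction z with
      | zero => simp
      | add x y hx hy => simp only [map_add, smul_add, hx, hy]
      | tmul x y => simp [mul_smul, mul_assoc]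

lemma one_tmul_mul_one_tmul (h k : H) :
    tmul act σ 1 h * tmul act σ 1 k = cocycleMul σ (h ⊗ₜ[R] k) := by
  rw [one_tmul_mul_tmul]
  have h₁ : ∀ z : H ⊗[R] H, mulLeftFactor (TensorProduct.map (act.act 1)
      (cocycleMul σ ∘ₗ (TensorProduct.mk R H H).flip k) z) =
      cocycleMul σ (TensorProduct.lid R H ((Coalgebra.counit (R := R)).rTensor H z) ⊗ₜ[R] k) := by
    intro z
    induction z with
    | zero => simp
    | add x y hx hy => simp only [map_add, TensorProduct.add_tmul, hx, hy]
    | tmul x y => simp [WeakAction.act_one, ← TensorProduct.smul_tmul']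
  rw [h₁, Coalgebra.rTensor_counit_comul]
  simp
  rfl

/-- `ρ(∑ σ(h₁ ⊗ k₁) # h₂ k₂) = ∑ σ(h₁ ⊗ k₁) # h₂ k₂ ⊗ h₃ k₃`. -/
lemma coaction_cocycleMul (z : H ⊗[R] H) :
    coaction act σ (cocycleMul σ z : A ⊗[R] H) =
      TensorProduct.map (cocycleMul σ) (LinearMap.mul' R H) (Coalgebra.comul z) := by
  have h₁ := congrArg (TensorProduct.map σ (TensorProduct.map (LinearMap.mul' R H)
    (LinearMap.mul' R H))) (Coalgebra.coassoc_apply (R := R) z)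
  have h₂ := congrArg (TensorProduct.assoc R A H H).symm h₁
  -- Multiplication of the bialgebra `H` is a coalgebra map; with coassociativity of `H ⊗ H` this is
  -- all that is needed.
  have h₃ : ∀ t : H ⊗[R] H, Coalgebra.comul (R := R) (LinearMap.mul' R H t) =
      TensorProduct.map (LinearMap.mul' R H) (LinearMap.mul' R H) (Coalgebra.comul t) :=
    fun t => (CoalgHomClass.map_comp_comul_apply (Bialgebra.mulCoalgHom R H) t).symm
  change (TensorProduct.assoc R A H H).symm
    ((Coalgebra.comul (R := R)).lTensor A (TensorProduct.map σ (LinearMap.mul' R H)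
      (Coalgebra.comul z))) = _
  refine Eq.trans ?_ (h₂.symm.trans ?_)
  · congr 1
    generalize (Coalgebra.comul z : (H ⊗[R] H) ⊗[R] (H ⊗[R] H)) = t
    induction t with
    | zero => simp
    | add x y hx hy => simp only [map_add, hx, hy]
    | tmul x y => simp [h₃]
  · generalize (Coalgebra.comul z : (H ⊗[R] H) ⊗[R] (H ⊗[R] H)) = t
    induction t with
    | zero => simp
    | add x y hx hy => simp only [map_add, hx, hy]
    | tmul x y =>
      simp only [cocycleMul, LinearMap.rTensor_tmul, TensorProduct.map_tmul, LinearMap.comp_apply]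
      generalize (Coalgebra.comul x : (H ⊗[R] H) ⊗[R] (H ⊗[R] H)) = t
      induction t with
      | zero => simp
      | add x y hx hy => simp only [map_add, TensorProduct.add_tmul, hx, hy]
      | tmul x y => simp

lemma coaction_smul (a : A) (x : CrossedProduct act σ) :
    coaction act σ (a • x) = a • coaction act σ x := by
  induction x using induction_on with
  | zero => simp
  | add x₁ x₂ h₁ h₂ => simp only [smul_add, map_add, h₁, h₂]
  | tmul b h =>
    change (TensorProduct.assoc R A H H).symm ((a * b) ⊗ₜ Coalgebra.comul h) =
      a • (TensorProduct.assoc R A H H).symm (b ⊗ₜ Coalgebra.comul h)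
    generalize (Coalgebra.comul h : H ⊗[R] H) = z
    induction z with
    | zero => simp
    | add x y hx hy => simp only [TensorProduct.tmul_add, map_add, smul_add, hx, hy]
    | tmul x y => simp [TensorProduct.smul_tmul']

lemma smul_tensor_mul (a : A) (x y : CrossedProduct act σ ⊗[R] H) :
    a • x * y = a • (x * y) := by
  induction x with
  | zero => simp
  | add x₁ x₂ h₁ h₂ => simp only [smul_add, add_mul, h₁, h₂]
  | tmul x h =>
    induction y with
    | zero => simp
    | add x₁ x₂ h₁ h₂ => simp only [smul_add, mul_add, h₁, h₂]
    | tmul y k => simp [TensorProduct.smul_tmul', smul_mul]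

variable (act σ) in
/-- The map `H → A #_σ H`, `h ↦ a # h`. -/
def tmulHom (a : A) : H →ₗ[R] CrossedProduct act σ := TensorProduct.mk R A H a

@[simp] lemma tmulHom_apply (a : A) (h : H) : tmulHom act σ a h = tmul act σ a h := rfl

lemma coaction_tmul (a : A) (h : H) : coaction act σ (tmul act σ a h) =
    (tmulHom act σ a).rTensor H (Coalgebra.comul h) := by
  change (TensorProduct.assoc R A H H).symm (a ⊗ₜ Coalgebra.comul h) =
    (TensorProduct.mk R A H a).rTensor H (Coalgebra.comul h)
  generalize (Coalgebra.comul h : H ⊗[R] H) = z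
  induction z with
  | zero => simp
  | add x y hx hy => simp only [TensorProduct.tmul_add, map_add, hx, hy]
  | tmul x y => simp

lemma coaction_coassoc (x : CrossedProduct act σ) :
    TensorProduct.assoc R (CrossedProduct act σ) H H
        ((coaction act σ).rTensor H (coaction act σ x)) =
      (Coalgebra.comul (R := R)).lTensor (CrossedProduct act σ) (coaction act σ x) := by
  induction x using induction_on with
  | zero => simp
  | add x₁ x₂ h₁ h₂ => simp only [map_add, h₁, h₂]
  | tmul a h =>
    have h₁ := congrArg ((tmulHom act σ a).rTensor (H ⊗[R] H))
      (Coalgebra.coassoc_apply (R := R) h)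
    rw [coaction_tmul]
    refine Eq.trans ?_ (h₁.trans ?_)
    · generalize (Coalgebra.comul h : H ⊗[R] H) = z
      induction z with
      | zero => simp
      | add x y hx hy => simp only [map_add, hx, hy]
      | tmul x y =>
        simp only [LinearMap.rTensor_tmul, tmulHom_apply, coaction_tmul]
        generalize (Coalgebra.comul x : H ⊗[R] H) = z
        induction z with
        | zero => simp
        | add x y hx hy => simp only [map_add, TensorProduct.add_tmul, hx, hy]
        | tmul x y => simp
    · generalize (Coalgebra.comul h : H ⊗[R] H) = z
      induction z with
      | zero => simp
      | add x y hx hy => simp only [map_add, hx, hy]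
      | tmul x y => rfl

/-- By `A`-linearity the left factor may be taken as `1 # h`. Then both sides come from the same
threefold coproduct of `h`, bracketed in two ways. Associativity of the crossed product plays no
role. -/
lemma coaction_mul (x y : CrossedProduct act σ) :
    coaction act σ (x * y) = coaction act σ x * coaction act σ y := by
  induction x using induction_on with
  | zero => simp
  | add x₁ x₂ h₁ h₂ => simp only [add_mul, map_add, h₁, h₂]
  | tmul a h =>
    rw [tmul_eq_smul, smul_mul, coaction_smul, coaction_smul, smul_tensor_mul]
    congr 1
    induction y using induction_on with
    | zero => simp
    | add x₁ x₂ h₁ h₂ => simp only [mul_add, map_add, h₁, h₂]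
    | tmul b k =>
      rw [one_tmul_mul_tmul, coaction_tmul, coaction_tmul]
      let C : H ⊗[R] H →ₗ[R] CrossedProduct act σ := cocycleMul σ
      -- For `κ = ∑ k₁ ⊗ k₂`, `Ψ κ` sends `h₁ ⊗ h₂ ⊗ h₃` to `∑ (h₁ b) C(h₂ ⊗ k₁) ⊗ h₃ k₂`.
      let Ψ : H ⊗[R] H → H ⊗[R] (H ⊗[R] H) →ₗ[R] CrossedProduct act σ ⊗[R] H := fun κ =>
        TensorProduct.lift (Algebra.lsmul R R (CrossedProduct act σ ⊗[R] H) :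
          A →ₐ[R] Module.End R (CrossedProduct act σ ⊗[R] H)).toLinearMap ∘ₗ
        TensorProduct.map (act.act b) (TensorProduct.map C (LinearMap.mul' R H) ∘ₗ
          (TensorProduct.tensorTensorTensorComm R H H H H).toLinearMap ∘ₗ
          (TensorProduct.mk R (H ⊗[R] H) (H ⊗[R] H)).flip κ)
      have h₁ : ∀ z, coaction act σ (mulLeftFactor (TensorProduct.map (act.act b)
          (cocycleMul σ ∘ₗ (TensorProduct.mk R H H).flip k) z) : A ⊗[R] H) =
          Ψ (Coalgebra.comul k) ((Coalgebra.comul (R := R)).lTensor H z) := by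
        intro z
        induction z with
        | zero =>
          simp only [map_zero]
          exact map_zero (coaction act σ)
        | add x y hx hy =>
          simp only [map_add, ← hx, ← hy]
          exact map_add (coaction act σ) _ _
        | tmul x y =>
          rw [TensorProduct.map_tmul, mulLeftFactor_tmul]
          refine (coaction_smul _ _).trans ?_
          congr 1
          exact coaction_cocycleMul _
      rw [h₁, ← Coalgebra.coassoc_apply]
      generalize (Coalgebra.comul h : H ⊗[R] H) = z
      generalize (Coalgebra.comul k : H ⊗[R] H) = κ
      induction κ with
      | zero => simp [Ψ]
      | add κ₁ κ₂ h₁ h₂ =>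
        simp only [map_add, mul_add, ← h₁, ← h₂]
        simp [Ψ, LinearMap.comp_add, TensorProduct.map_add_right]
      | tmul k₁ k₂ =>
        induction z with
        | zero => simp
        | add x y hx hy => simp only [map_add, add_mul, hx, hy]
        | tmul x y =>
          simp only [LinearMap.rTensor_tmul, tmulHom_apply, Algebra.TensorProduct.tmul_mul_tmul,
            one_tmul_mul_tmul]
          generalize (Coalgebra.comul x : H ⊗[R] H) = z
          induction z with
          | zero =>
            simp only [map_zero, TensorProduct.zero_tmul]
            exact (TensorProduct.zero_tmul (CrossedProduct act σ) (y * k₂)).symm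
          | add x y hx hy =>
            simp only [map_add, TensorProduct.add_tmul, hx, hy]
            exact (TensorProduct.add_tmul (M := CrossedProduct act σ) _ _ _).symm
          | tmul x₁ x₂ =>
            rw [TensorProduct.map_tmul, mulLeftFactor_tmul]
            rfl

end CrossedProduct

end

/-! ### Functoriality of convolution algebras. -/

section Convolution

variable {R : Type u} [CommRing R]
variable {C D E : Type*} [AddCommGroup C] [Module R C] [Coalgebra R C]
  [AddCommGroup D] [Module R D] [Coalgebra R D] [AddCommGroup E] [Module R E] [Coalgebra R E]
variable {A B : Type*} [Ring A] [Algebra R A] [Ring B] [Algebra R B]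

/-- Precomposition with a coalgebra map is a morphism of convolution rings. -/
def convComp (c : C →ₗc[R] D) : WithConv (D →ₗ[R] B) →+* WithConv (C →ₗ[R] B) where
  toFun f := toConv (f.ofConv ∘ₗ c.toLinearMap)
  map_one' := by ext; simp
  map_mul' f g := congrArg toConv (LinearMap.convMul_comp_coalgHom_distrib f g c)
  map_zero' := rfl
  map_add' _ _ := rfl

@[simp] lemma convComp_apply (c : C →ₗc[R] D) (f : WithConv (D →ₗ[R] B)) (x : C) :
    convComp c f x = f (c x) := rfl

lemma convComp_convComp (c : C →ₗc[R] D) (d : D →ₗc[R] E) (f : WithConv (E →ₗ[R] B)) :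
    convComp c (convComp d f) = convComp (d.comp c) f := rfl

/-- Postcomposition with an algebra map is a morphism of convolution rings. -/
def convMap (i : A →ₐ[R] B) : WithConv (C →ₗ[R] A) →+* WithConv (C →ₗ[R] B) where
  toFun f := toConv (i.toLinearMap ∘ₗ f.ofConv)
  map_one' := by ext; simp
  map_mul' f g := congrArg toConv (LinearMap.algHom_comp_convMul_distrib i f g)
  map_zero' := by ext; simp
  map_add' _ _ := by ext; simp

@[simp] lemma convMap_apply (i : A →ₐ[R] B) (f : WithConv (C →ₗ[R] A)) (x : C) :
    convMap i f x = i (f x) := rfl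

lemma convComp_convMap (c : C →ₗc[R] D) (i : A →ₐ[R] B) (f : WithConv (D →ₗ[R] A)) :
    convComp c (convMap i f) = convMap i (convComp c f) := rfl

variable (R C D) in
/-- The coalgebra map `id ⊗ ε : C ⊗ D → C`. -/
def coalgFst : C ⊗[R] D →ₗc[R] C :=
  (Coalgebra.TensorProduct.rid R R C : C ⊗[R] R →ₗc[R] C).comp
    (Coalgebra.TensorProduct.map (CoalgHom.id R C) (Coalgebra.counitCoalgHom R D))

variable (R C D) in
/-- The coalgebra map `ε ⊗ id : C ⊗ D → D`. -/
def coalgSnd : C ⊗[R] D →ₗc[R] D :=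
  (Coalgebra.TensorProduct.lid R D : R ⊗[R] D →ₗc[R] D).comp
    (Coalgebra.TensorProduct.map (Coalgebra.counitCoalgHom R C) (CoalgHom.id R D))

@[simp] lemma coalgFst_tmul (x : C) (y : D) :
    coalgFst R C D (x ⊗ₜ y) = Coalgebra.counit (R := R) y • x := rfl

@[simp] lemma coalgSnd_tmul (x : C) (y : D) :
    coalgSnd R C D (x ⊗ₜ y) = Coalgebra.counit (R := R) x • y := rfl

/-- `(F ⋆ g)(x ⊗ y) = ∑ F(x ⊗ y₁) g(y₂)`. -/
lemma mul_convComp_coalgSnd (F : WithConv (C ⊗[R] D →ₗ[R] B)) (g : WithConv (D →ₗ[R] B))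
    (x : C) (y : D) : (F * convComp (coalgSnd R C D) g) (x ⊗ₜ y) =
      (toConv (F.ofConv ∘ₗ TensorProduct.mk R C D x) * g) y := by
  have h : ∀ (X : C ⊗[R] C) (Y : D ⊗[R] D), LinearMap.mul' R B
      (TensorProduct.map F.ofConv (convComp (coalgSnd R C D) g).ofConv
        (TensorProduct.tensorTensorTensorComm R C C D D (X ⊗ₜ Y))) =
      LinearMap.mul' R B (TensorProduct.map (F.ofConv ∘ₗ TensorProduct.mk R C D
        (TensorProduct.rid R C ((Coalgebra.counit (R := R)).lTensor C X))) g.ofConv Y) := by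
    intro X Y
    induction X with
    | zero => simp
    | add x y hx hy =>
      simp only [TensorProduct.add_tmul, map_add, hx, hy, LinearMap.comp_add,
        TensorProduct.map_add_left, LinearMap.add_apply]
    | tmul x₁ x₂ =>
      induction Y with
      | zero => simp
      | add x y hx hy => simp only [TensorProduct.tmul_add, map_add, hx, hy]
      | tmul y₁ y₂ => simp
  refine (h _ _).trans ?_
  simp

/-- `(F ⋆ g)(x ⊗ y) = ∑ F(x₁ ⊗ y) g(x₂)`. -/
lemma mul_convComp_coalgFst (F : WithConv (C ⊗[R] D →ₗ[R] B)) (g : WithConv (C →ₗ[R] B))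
    (x : C) (y : D) : (F * convComp (coalgFst R C D) g) (x ⊗ₜ y) =
      (toConv (F.ofConv ∘ₗ (TensorProduct.mk R C D).flip y) * g) x := by
  have h : ∀ (X : C ⊗[R] C) (Y : D ⊗[R] D), LinearMap.mul' R B
      (TensorProduct.map F.ofConv (convComp (coalgFst R C D) g).ofConv
        (TensorProduct.tensorTensorTensorComm R C C D D (X ⊗ₜ Y))) =
      LinearMap.mul' R B (TensorProduct.map (F.ofConv ∘ₗ (TensorProduct.mk R C D).flip
        (TensorProduct.rid R D ((Coalgebra.counit (R := R)).lTensor D Y))) g.ofConv X) := by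
    intro X Y
    induction Y with
    | zero => simp
    | add x y hx hy =>
      simp only [TensorProduct.tmul_add, map_add, hx, hy, LinearMap.comp_add,
        TensorProduct.map_add_left, LinearMap.add_apply]
    | tmul y₁ y₂ =>
      induction X with
      | zero => simp
      | add x y hx hy => simp only [TensorProduct.add_tmul, map_add, hx, hy]
      | tmul x₁ x₂ => simp
  refine (h _ _).trans ?_
  simp

/-- This turns a pointwise product `f(x) g(y)` in two variables into a convolution product on `C ⊗
D`, so that identities in several variables can be handled as ring identities. -/
lemma convComp_coalgFst_mul_convComp_coalgSnd (f : WithConv (C →ₗ[R] B))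
    (g : WithConv (D →ₗ[R] B)) (x : C) (y : D) :
    (convComp (coalgFst R C D) f * convComp (coalgSnd R C D) g) (x ⊗ₜ y) = f x * g y := by
  rw [mul_convComp_coalgSnd]
  have h : ∀ Y : D ⊗[R] D, LinearMap.mul' R B (TensorProduct.map
      ((convComp (coalgFst R C D) f).ofConv ∘ₗ TensorProduct.mk R C D x) g.ofConv Y) =
      f x * g (TensorProduct.lid R D ((Coalgebra.counit (R := R)).rTensor D Y)) := by
    intro Y
    induction Y with
    | zero => simp
    | add x y hx hy => simp only [map_add, hx, hy, mul_add]
    | tmul y₁ y₂ => simp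
  refine (h _).trans ?_
  simp

end Convolution

/-! ### Convolution identities for the antipode and for `∑ S(k₁) ⊗ k₂`. -/

section Antipode

variable {R : Type u} [CommRing R] {H : Type v} [Ring H] [HopfAlgebra R H]
variable {B : Type*} [Ring B] [Algebra R B]

open HopfAlgebra

lemma antipode_convMul_algHom (f : H →ₐ[R] B) :
    toConv (f.toLinearMap ∘ₗ antipode R) * toConv f.toLinearMap = 1 := by
  have := congrArg (convMap f) (LinearMap.antipode_mul_id (R := R) (C := H))
  rwa [map_mul, map_one] at this

lemma algHom_convMul_antipode (f : H →ₐ[R] B) :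
    toConv f.toLinearMap * toConv (f.toLinearMap ∘ₗ antipode R) = 1 := by
  have := congrArg (convMap f) (LinearMap.id_mul_antipode (R := R) (C := H))
  rwa [map_mul, map_one] at this

/-- If `f = g ⋆ h` for algebra maps, then `f ∘ S = (h ∘ S) ⋆ (g ∘ S)`. -/
lemma algHom_comp_antipode_of_eq_mul {f g h : H →ₐ[R] B}
    (hf : toConv f.toLinearMap = toConv g.toLinearMap * toConv h.toLinearMap) :
    toConv (f.toLinearMap ∘ₗ antipode R) =
      toConv (h.toLinearMap ∘ₗ antipode R) * toConv (g.toLinearMap ∘ₗ antipode R) := by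
  -- Convolution inverses are unique, and composing an algebra map with `S` gives its inverse; the
  -- candidate on the right only has to be a right inverse of `f`.
  refine left_inv_eq_right_inv (antipode_convMul_algHom f) ?_
  rw [hf, mul_assoc, ← mul_assoc (toConv h.toLinearMap), algHom_convMul_antipode, one_mul,
    algHom_convMul_antipode]

variable (R H) in
/-- `k ↦ ∑ S(k₁) ⊗ k₂`. -/
def antipodeComul : H →ₗ[R] H ⊗[R] H := (antipode R).rTensor H ∘ₗ Coalgebra.comul

/-- `∑ Δ(S(k₁)) ⊗ k₂ = ∑ S(k₂) ⊗ S(k₁) ⊗ k₃`. -/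
lemma comul_rTensor_antipodeComul (k : H) :
    (Coalgebra.comul (R := R)).rTensor H (antipodeComul R H k) =
      (TensorProduct.assoc R H H H).symm (TensorProduct.leftComm R H H H
        (TensorProduct.map (antipode R) ((antipode R).rTensor H) (comul₃ R H k))) := by
  let ι₁ : H →ₐ[R] (H ⊗[R] H) ⊗[R] H :=
    Algebra.TensorProduct.includeLeft.comp Algebra.TensorProduct.includeLeft
  let ι₂ : H →ₐ[R] (H ⊗[R] H) ⊗[R] H :=
    Algebra.TensorProduct.includeLeft.comp Algebra.TensorProduct.includeRight
  let ι₃ : H →ₐ[R] (H ⊗[R] H) ⊗[R] H := Algebra.TensorProduct.includeRight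
  let δ : H →ₐ[R] (H ⊗[R] H) ⊗[R] H :=
    Algebra.TensorProduct.includeLeft.comp (Bialgebra.comulAlgHom R H)
  have hδ : toConv δ.toLinearMap = toConv ι₁.toLinearMap * toConv ι₂.toLinearMap := by
    ext k
    change (Coalgebra.comul (R := R) k) ⊗ₜ[R] (1 : H) =
      LinearMap.mul' R _ (TensorProduct.map ι₁.toLinearMap ι₂.toLinearMap (Coalgebra.comul k))
    generalize (Coalgebra.comul k : H ⊗[R] H) = z
    induction z with
    | zero => simp
    | add x y hx hy => simp only [map_add, TensorProduct.add_tmul, hx, hy]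
    | tmul x y => simp [ι₁, ι₂]
  -- The coproduct is the convolution product of the two inclusions, so its composite with `S` is
  -- the product of their inverses in reverse order. This replaces an appeal to
  -- anticomultiplicativity of `S`.
  have h := algHom_comp_antipode_of_eq_mul hδ
  have h₁ : toConv ((Coalgebra.comul (R := R)).rTensor H ∘ₗ antipodeComul R H) =
      toConv (δ.toLinearMap ∘ₗ antipode R) * toConv ι₃.toLinearMap := by
    ext k
    change (Coalgebra.comul (R := R)).rTensor H ((antipode R).rTensor H (Coalgebra.comul k)) =
      LinearMap.mul' R _ (TensorProduct.map (δ.toLinearMap ∘ₗ antipode R) ι₃.toLinearMap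
        (Coalgebra.comul k))
    generalize (Coalgebra.comul k : H ⊗[R] H) = z
    induction z with
    | zero => simp
    | add x y hx hy => simp only [map_add, hx, hy]
    | tmul x y => simp [δ, ι₃]
  rw [h, mul_assoc] at h₁
  refine (LinearMap.congr_fun (congrArg ofConv h₁) k).trans ?_
  change LinearMap.mul' R _ (TensorProduct.map (ι₂.toLinearMap ∘ₗ antipode R)
    (LinearMap.mul' R _ ∘ₗ TensorProduct.map (ι₁.toLinearMap ∘ₗ antipode R) ι₃.toLinearMap ∘ₗ
      Coalgebra.comul) (Coalgebra.comul k)) = (TensorProduct.assoc R H H H).symm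
      (TensorProduct.leftComm R H H H (TensorProduct.map (antipode R) ((antipode R).rTensor H)
        ((Coalgebra.comul (R := R)).lTensor H (Coalgebra.comul k))))
  generalize (Coalgebra.comul k : H ⊗[R] H) = z
  induction z with
  | zero => simp
  | add x y hx hy => simp only [map_add, hx, hy]
  | tmul x y =>
    simp only [LinearMap.lTensor_tmul, TensorProduct.map_tmul, LinearMap.comp_apply]
    generalize (Coalgebra.comul y : H ⊗[R] H) = z
    induction z with
    | zero => simp
    | add x y hx hy => simp only [map_add, TensorProduct.tmul_add, hx, hy]
    | tmul y z => simp [ι₁, ι₂, ι₃]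

/-- For `t = ∑ S(k₁) ⊗ k₂`, `∑ l₁ m₁ ⊗ l₂ ⊗ m₂ = 1 ⊗ t`. -/
lemma mul_comul_antipodeComul (k : H) :
    (LinearMap.mul' R H).rTensor (H ⊗[R] H) (Coalgebra.comul (antipodeComul R H k)) =
      1 ⊗ₜ[R] antipodeComul R H k := by
  let ι₁ : H →ₐ[R] H ⊗[R] (H ⊗[R] H) := Algebra.TensorProduct.includeLeft
  let ι₂ : H →ₐ[R] H ⊗[R] (H ⊗[R] H) :=
    Algebra.TensorProduct.includeRight.comp Algebra.TensorProduct.includeLeft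
  let ι₃ : H →ₐ[R] H ⊗[R] (H ⊗[R] H) :=
    Algebra.TensorProduct.includeRight.comp Algebra.TensorProduct.includeRight
  -- With `u(h) = ∑ h₁ ⊗ h₂ ⊗ 1` and `v(h) = ∑ h₁ ⊗ 1 ⊗ h₂`, the left side is `(u ∘ S) ⋆ v`, that is
  -- `(ι₂ ∘ S) ⋆ (ι₁ ∘ S) ⋆ ι₁ ⋆ ι₃`, and the two middle factors cancel.
  let u : H →ₐ[R] H ⊗[R] (H ⊗[R] H) := (Algebra.TensorProduct.map (AlgHom.id R H)
    Algebra.TensorProduct.includeLeft).comp (Bialgebra.comulAlgHom R H)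
  let v : H →ₐ[R] H ⊗[R] (H ⊗[R] H) := (Algebra.TensorProduct.map (AlgHom.id R H)
    Algebra.TensorProduct.includeRight).comp (Bialgebra.comulAlgHom R H)
  have hu : toConv u.toLinearMap = toConv ι₁.toLinearMap * toConv ι₂.toLinearMap := by
    ext k
    change Algebra.TensorProduct.map (AlgHom.id R H) Algebra.TensorProduct.includeLeft
      (Coalgebra.comul (R := R) k) =
      LinearMap.mul' R _ (TensorProduct.map ι₁.toLinearMap ι₂.toLinearMap (Coalgebra.comul k))
    generalize (Coalgebra.comul k : H ⊗[R] H) = z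
    induction z with
    | zero => simp
    | add x y hx hy => simp only [map_add, hx, hy]
    | tmul x y => simp [ι₁, ι₂]
  have hv : toConv v.toLinearMap = toConv ι₁.toLinearMap * toConv ι₃.toLinearMap := by
    ext k
    change Algebra.TensorProduct.map (AlgHom.id R H) Algebra.TensorProduct.includeRight
      (Coalgebra.comul (R := R) k) =
      LinearMap.mul' R _ (TensorProduct.map ι₁.toLinearMap ι₃.toLinearMap (Coalgebra.comul k))
    generalize (Coalgebra.comul k : H ⊗[R] H) = z
    induction z with
    | zero => simp
    | add x y hx hy => simp only [map_add, hx, hy]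
    | tmul x y => simp [ι₁, ι₃]
  have h₁ : toConv ((LinearMap.mul' R H).rTensor (H ⊗[R] H) ∘ₗ Coalgebra.comul ∘ₗ
      antipodeComul R H) = toConv (u.toLinearMap ∘ₗ antipode R) * toConv v.toLinearMap := by
    ext k
    change (LinearMap.mul' R H).rTensor (H ⊗[R] H) (Coalgebra.comul
        ((antipode R).rTensor H (Coalgebra.comul k))) =
      LinearMap.mul' R _ (TensorProduct.map (u.toLinearMap ∘ₗ antipode R) v.toLinearMap
        (Coalgebra.comul k))
    generalize (Coalgebra.comul k : H ⊗[R] H) = z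
    induction z with
    | zero => simp
    | add x y hx hy => simp only [map_add, hx, hy]
    | tmul x y =>
      simp only [LinearMap.rTensor_tmul, TensorProduct.map_tmul, LinearMap.comp_apply, u, v,
        TensorProduct.comul_tmul, AlgHom.toLinearMap_apply, AlgHom.comp_apply,
        Bialgebra.comulAlgHom_apply, LinearMap.mul'_apply]
      generalize (Coalgebra.comul (antipode R x) : H ⊗[R] H) = z
      generalize (Coalgebra.comul y : H ⊗[R] H) = z'
      induction z with
      | zero => simp
      | add x y hx hy => simp only [map_add, TensorProduct.add_tmul, add_mul, hx, hy]
      | tmul x₁ x₂ =>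
        induction z' with
        | zero => simp
        | add x y hx hy => simp only [map_add, TensorProduct.tmul_add, mul_add, hx, hy]
        | tmul y₁ y₂ => simp
  rw [algHom_comp_antipode_of_eq_mul hu, hv, mul_assoc, ← mul_assoc (toConv (ι₁.toLinearMap ∘ₗ _)),
    antipode_convMul_algHom, one_mul] at h₁
  refine (LinearMap.congr_fun (congrArg ofConv h₁) k).trans ?_
  change LinearMap.mul' R _ (TensorProduct.map (ι₂.toLinearMap ∘ₗ antipode R) ι₃.toLinearMap
    (Coalgebra.comul k)) = 1 ⊗ₜ[R] (antipode R).rTensor H (Coalgebra.comul k)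
  generalize (Coalgebra.comul k : H ⊗[R] H) = z
  induction z with
  | zero => simp
  | add x y hx hy => simp only [map_add, TensorProduct.tmul_add, hx, hy]
  | tmul x y => simp [ι₂, ι₃]

lemma toConv_comul : toConv (Coalgebra.comul (R := R) (A := H)) =
    toConv (Algebra.TensorProduct.includeLeft : H →ₐ[R] H ⊗[R] H).toLinearMap *
      toConv (Algebra.TensorProduct.includeRight : H →ₐ[R] H ⊗[R] H).toLinearMap := by
  ext k
  change (Coalgebra.comul (R := R) k) = LinearMap.mul' R _ (TensorProduct.map
    (Algebra.TensorProduct.includeLeft : H →ₐ[R] H ⊗[R] H).toLinearMap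
    (Algebra.TensorProduct.includeRight : H →ₐ[R] H ⊗[R] H).toLinearMap (Coalgebra.comul k))
  generalize (Coalgebra.comul k : H ⊗[R] H) = z
  induction z with
  | zero => simp
  | add x y hx hy => simp only [map_add, ← hx, ← hy]
  | tmul x y => simp

/-- `∑ k₂ ⊗ S(k₁) k₃` is `∑ (1 ⊗ S(k₁)) Δ(k₂)`. In this form the twist is undone by convolving with
the right inclusion. -/
lemma toConv_twistedComul : toConv (twistedComul R H) =
    toConv ((Algebra.TensorProduct.includeRight : H →ₐ[R] H ⊗[R] H).toLinearMap ∘ₗ antipode R) *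
      toConv Coalgebra.comul := by
  ext k
  rw [toConv_comul]
  change (LinearMap.mul' R H ∘ₗ (antipode R).rTensor H).lTensor H (TensorProduct.leftComm R H H H
      ((Coalgebra.comul (R := R)).lTensor H (Coalgebra.comul k))) =
    LinearMap.mul' R _ (TensorProduct.map ((Algebra.TensorProduct.includeRight :
      H →ₐ[R] H ⊗[R] H).toLinearMap ∘ₗ antipode R) (LinearMap.mul' R _ ∘ₗ TensorProduct.map
        (Algebra.TensorProduct.includeLeft : H →ₐ[R] H ⊗[R] H).toLinearMap
        (Algebra.TensorProduct.includeRight : H →ₐ[R] H ⊗[R] H).toLinearMap ∘ₗ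
          Coalgebra.comul) (Coalgebra.comul k))
  hopf_tensor_induction (Coalgebra.comul (R := R) k) with x y
  simp only [LinearMap.lTensor_tmul, TensorProduct.map_tmul, LinearMap.comp_apply]
  generalize (Coalgebra.comul y : H ⊗[R] H) = z
  induction z with
  | zero => simp
  | add x y hx hy => simp only [map_add, TensorProduct.tmul_add, hx, hy]
  | tmul y z => simp

/-- Multiplying the second leg of `∑ k₃ ⊗ S(k₂) k₄` by `k₁` from the left gives `∑ k₁ ⊗ k₂`. -/
lemma includeRight_mul_twistedComul :
    toConv (Algebra.TensorProduct.includeRight : H →ₐ[R] H ⊗[R] H).toLinearMap *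
      toConv (twistedComul R H) = toConv Coalgebra.comul := by
  rw [toConv_twistedComul, ← mul_assoc, algHom_convMul_antipode, one_mul]

/-- `∑ F(S(k₁) ⊗ k₂) g(k₃)` is the value of the convolution product of `F` and `g ∘ (ε ⊗ id)` at
`∑ S(k₁) ⊗ k₂`. -/
lemma mul_convComp_coalgSnd_antipodeComul (F : WithConv (H ⊗[R] H →ₗ[R] B))
    (g : WithConv (H →ₗ[R] B)) :
    toConv ((F * convComp (coalgSnd R H H) g).ofConv ∘ₗ antipodeComul R H) =
      toConv (F.ofConv ∘ₗ antipodeComul R H) * g := by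
  ext k
  have h := congrArg (LinearMap.mul' R B ∘ₗ TensorProduct.map
    (F.ofConv ∘ₗ (antipode R).rTensor H) g.ofConv ∘ₗ (TensorProduct.assoc R H H H).symm.toLinearMap)
    (Coalgebra.coassoc_apply (R := R) k)
  refine Eq.trans ?_ (h.symm.trans ?_)
  · change (F * convComp (coalgSnd R H H) g) ((antipode R).rTensor H (Coalgebra.comul k)) = _
    generalize (Coalgebra.comul k : H ⊗[R] H) = z
    induction z with
    | zero => simp
    | add x y hx hy => simp only [map_add, hx, hy]
    | tmul x y =>
      rw [LinearMap.rTensor_tmul, mul_convComp_coalgSnd, LinearMap.lTensor_tmul]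
      change LinearMap.mul' R B (TensorProduct.map _ _ (Coalgebra.comul y)) = _
      generalize (Coalgebra.comul y : H ⊗[R] H) = z
      induction z with
      | zero => simp
      | add x y hx hy => simp only [map_add, TensorProduct.tmul_add, hx, hy]
      | tmul y z => simp
  · change _ = LinearMap.mul' R B (TensorProduct.map (F.ofConv ∘ₗ antipodeComul R H) g.ofConv
      (Coalgebra.comul k))
    generalize (Coalgebra.comul k : H ⊗[R] H) = z
    induction z with
    | zero => simp
    | add x y hx hy => simp only [map_add, hx, hy]
    | tmul x y => simp [antipodeComul]

/-- The value of the convolution product of `G` and `g ∘ (id ⊗ ε)` at `∑ S(k₁) ⊗ k₂` is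
`∑ G(S(k₂) ⊗ k₃) g(S(k₁))`. -/
lemma mul_convComp_coalgFst_antipodeComul (G : WithConv (H ⊗[R] H →ₗ[R] B))
    (g : WithConv (H →ₗ[R] B)) (k : H) :
    (G * convComp (coalgFst R H H) g) (antipodeComul R H k) =
      LinearMap.mul' R B (TensorProduct.comm R B B (TensorProduct.map (g.ofConv ∘ₗ antipode R)
        (G.ofConv ∘ₗ antipodeComul R H) (Coalgebra.comul k))) := by
  have h := congrArg (LinearMap.mul' R B ∘ₗ TensorProduct.map G.ofConv g.ofConv ∘ₗ
    (TensorProduct.rightComm R H H H).toLinearMap) (comul_rTensor_antipodeComul (R := R) k)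
  refine Eq.trans ?_ (h.trans ?_)
  · generalize antipodeComul R H k = z
    induction z with
    | zero => simp
    | add x y hx hy => simp only [map_add, hx, hy]
    | tmul x y =>
      rw [LinearMap.rTensor_tmul, mul_convComp_coalgFst]
      change LinearMap.mul' R B (TensorProduct.map _ _ (Coalgebra.comul x)) = _
      generalize (Coalgebra.comul x : H ⊗[R] H) = z
      induction z with
      | zero => simp
      | add x y hx hy => simp only [map_add, TensorProduct.add_tmul, hx, hy]
      | tmul y z => simp
  · rw [show comul₃ R H k = (Coalgebra.comul (R := R)).lTensor H (Coalgebra.comul k) from rfl]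
    generalize (Coalgebra.comul k : H ⊗[R] H) = z
    induction z with
    | zero => simp
    | add x y hx hy => simp only [map_add, hx, hy]
    | tmul x y =>
      rw [LinearMap.lTensor_tmul, TensorProduct.map_tmul, TensorProduct.map_tmul,
        LinearMap.comp_apply G.ofConv, antipodeComul, LinearMap.comp_apply _ Coalgebra.comul]
      generalize (Coalgebra.comul y : H ⊗[R] H) = z
      induction z with
      | zero => simp
      | add x y hx hy => simp only [map_add, TensorProduct.tmul_add, hx, hy]
      | tmul y z => simp

variable (R H) in
/-- `k ↦ ∑ k₁ ⊗ S(k₂) ⊗ k₃`. -/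
def antipodeComul₃ : H →ₗ[R] H ⊗[R] (H ⊗[R] H) :=
  (antipodeComul R H).lTensor H ∘ₗ Coalgebra.comul

variable (R H) in
/-- The coalgebra map `x ⊗ y ⊗ z ↦ x ⊗ y z`. -/
def coalgMulRight : H ⊗[R] (H ⊗[R] H) →ₗc[R] H ⊗[R] H :=
  Coalgebra.TensorProduct.map (CoalgHom.id R H) (Bialgebra.mulCoalgHom R H)

variable (R H) in
/-- The coalgebra map `x ⊗ y ⊗ z ↦ x y ⊗ z`. -/
def coalgMulLeft : H ⊗[R] (H ⊗[R] H) →ₗc[R] H ⊗[R] H :=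
  (Coalgebra.TensorProduct.map (Bialgebra.mulCoalgHom R H) (CoalgHom.id R H)).comp
    ((Coalgebra.TensorProduct.assoc R R H H H).symm : H ⊗[R] (H ⊗[R] H) →ₗc[R] (H ⊗[R] H) ⊗[R] H)

lemma coalgMulRight_tmul (x : H) (z : H ⊗[R] H) :
    coalgMulRight R H (x ⊗ₜ z) = x ⊗ₜ LinearMap.mul' R H z := rfl

lemma coalgMulLeft_tmul (x y z : H) :
    coalgMulLeft R H (x ⊗ₜ (y ⊗ₜ z)) = (x * y) ⊗ₜ z := rfl

/-- After rebracketing by coassociativity, `∑ k₁ S(k₂) ⊗ k₃` collapses by the antipode axiom and the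
counit. -/
lemma coalgMulLeft_antipodeComul₃ (k : H) :
    coalgMulLeft R H (antipodeComul₃ R H k) = 1 ⊗ₜ[R] k := by
  have h := congrArg ((LinearMap.mul' R H ∘ₗ (antipode R).lTensor H).rTensor H ∘ₗ
    (TensorProduct.assoc R H H H).symm.toLinearMap) (Coalgebra.coassoc_apply (R := R) k)
  refine Eq.trans ?_ (h.symm.trans ?_)
  · rw [antipodeComul₃, LinearMap.comp_apply]
    generalize (Coalgebra.comul k : H ⊗[R] H) = z
    induction z with
    | zero => simp
    | add x y hx hy => simp only [map_add, hx, hy]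
    | tmul x y =>
      simp only [LinearMap.lTensor_tmul, LinearMap.comp_apply, antipodeComul]
      generalize (Coalgebra.comul y : H ⊗[R] H) = z
      induction z with
      | zero => simp
      | add x y hx hy => simp only [map_add, TensorProduct.tmul_add, hx, hy]
      | tmul y z => simp [coalgMulLeft_tmul]
  · have h₁ : ∀ z : H ⊗[R] H, ((LinearMap.mul' R H ∘ₗ (antipode R).lTensor H).rTensor H ∘ₗ
        (TensorProduct.assoc R H H H).symm.toLinearMap) (TensorProduct.assoc R H H H
        ((Coalgebra.comul (R := R)).rTensor H z)) =
        1 ⊗ₜ[R] TensorProduct.lid R H ((Coalgebra.counit (R := R)).rTensor H z) := by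
      intro z
      induction z with
      | zero => simp
      | add x y hx hy => simp only [map_add, TensorProduct.tmul_add, hx, hy]
      | tmul x y =>
        simp [Algebra.algebraMap_eq_smul_one, TensorProduct.smul_tmul]
    rw [h₁]
    simp

/-- At `∑ k₁ ⊗ S(k₂) ⊗ k₃`, the convolution product of `x ⊗ y ⊗ z ↦ F(x ⊗ y z)` and
`x ⊗ y ⊗ z ↦ G(x y ⊗ z)` takes the value `∑ F(k₁ ⊗ 1) G(1 ⊗ k₂)`. -/
lemma convComp_coalgMulRight_mul_convComp_coalgMulLeft (F G : WithConv (H ⊗[R] H →ₗ[R] B)) :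
    toConv ((convComp (coalgMulRight R H) F * convComp (coalgMulLeft R H) G).ofConv ∘ₗ
      antipodeComul₃ R H) = toConv (F.ofConv ∘ₗ (TensorProduct.mk R H H).flip 1) *
        toConv (G.ofConv ∘ₗ TensorProduct.mk R H H 1) := by
  ext k
  have h := congrArg (LinearMap.mul' R B ∘ₗ TensorProduct.map
    (F.ofConv ∘ₗ (TensorProduct.mk R H H).flip 1)
    (G.ofConv ∘ₗ (coalgMulLeft R H).toLinearMap ∘ₗ (antipodeComul R H).lTensor H))
    (Coalgebra.coassoc_apply (R := R) k)
  refine Eq.trans ?_ (h.trans ?_)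
  · change (convComp (coalgMulRight R H) F * convComp (coalgMulLeft R H) G)
      ((antipodeComul R H).lTensor H (Coalgebra.comul k)) = _
    generalize (Coalgebra.comul k : H ⊗[R] H) = z
    induction z with
    | zero => simp
    | add x y hx hy => simp only [map_add, hx, hy]
    | tmul x y =>
      simp only [LinearMap.lTensor_tmul, LinearMap.rTensor_tmul]
      have h₁ := mul_comul_antipodeComul (R := R) y
      have h₂ : ∀ X : H ⊗[R] H, LinearMap.mul' R B (TensorProduct.map
          (convComp (coalgMulRight R H) F).ofConv (convComp (coalgMulLeft R H) G).ofConv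
          (TensorProduct.tensorTensorTensorComm R H H (H ⊗[R] H) (H ⊗[R] H)
            (X ⊗ₜ Coalgebra.comul (antipodeComul R H y)))) =
          LinearMap.mul' R B (TensorProduct.map (F.ofConv ∘ₗ (TensorProduct.mk R H H).flip 1)
            (G.ofConv ∘ₗ (coalgMulLeft R H).toLinearMap ∘ₗ (antipodeComul R H).lTensor H)
            (TensorProduct.assoc R H H H (X ⊗ₜ y))) := by
        intro X
        induction X with
        | zero => simp
        | add x y hx hy => simp only [map_add, TensorProduct.add_tmul, hx, hy]
        | tmul x₁ x₂ =>
          have h₃ : ∀ t : (H ⊗[R] H) ⊗[R] (H ⊗[R] H), LinearMap.mul' R B (TensorProduct.map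
              (convComp (coalgMulRight R H) F).ofConv (convComp (coalgMulLeft R H) G).ofConv
              (TensorProduct.tensorTensorTensorComm R H H (H ⊗[R] H) (H ⊗[R] H)
                ((x₁ ⊗ₜ x₂) ⊗ₜ t))) =
              LinearMap.mul' R B (TensorProduct.map (F.ofConv ∘ₗ TensorProduct.mk R H H x₁)
                (G.ofConv ∘ₗ (coalgMulLeft R H).toLinearMap ∘ₗ TensorProduct.mk R H (H ⊗[R] H) x₂)
                ((LinearMap.mul' R H).rTensor (H ⊗[R] H) t)) := by
            intro t
            induction t with
            | zero => simp
            | add x y hx hy => simp only [map_add, TensorProduct.tmul_add, hx, hy]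
            | tmul s t => simp [coalgMulRight_tmul]
          rw [h₃, h₁]
          simp
      exact h₂ _
  · change _ = LinearMap.mul' R B (TensorProduct.map _ _ (Coalgebra.comul k))
    generalize (Coalgebra.comul k : H ⊗[R] H) = z
    induction z with
    | zero => simp
    | add x y hx hy => simp only [map_add, hx, hy]
    | tmul x y =>
      have := coalgMulLeft_antipodeComul₃ (R := R) y
      rw [antipodeComul₃, LinearMap.comp_apply] at this
      simp [this]

end Antipode

/-! ### Crossed products with invertible cocycle are cleft: `j` is convolution invertible. -/

section Cleft

variable {R : Type u} [CommRing R] {H : Type v} [Ring H] [HopfAlgebra R H]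
variable {A : Type w} [Ring A] [Algebra R A] {B : Type*} [Ring B] [Algebra R B]

open HopfAlgebra

/-- Abstract form of a crossed product `B = A #_σ H`: an algebra map `i : A → B` and a linear map
`j : H → B` with the commutation rules of `a # 1` and `1 # h`, and a linear map `π : B → A` which
is `id ⊗ ε`. -/
structure IsCrossed (act : WeakAction R H A) (σ : H ⊗[R] H →ₗ[R] A) (i : A →ₐ[R] B)
    (j : H →ₗ[R] B) (π : B →ₗ[R] A) : Prop where
  apply_one : j 1 = 1
  mul_incl : ∀ h a, j h * i a = LinearMap.mul' R B
    (TensorProduct.map (i.toLinearMap ∘ₗ act.act a) j (Coalgebra.comul h))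
  mul_mul : ∀ z, LinearMap.mul' R B (TensorProduct.map j j z) = LinearMap.mul' R B
    (TensorProduct.map (i.toLinearMap ∘ₗ σ) (j ∘ₗ LinearMap.mul' R H) (Coalgebra.comul z))
  proj : ∀ a h, π (i a * j h) = Coalgebra.counit (R := R) h • a

lemma coalgHom_ext_threefold {C D E F : Type*} [AddCommGroup C] [Module R C]
    [Coalgebra R C] [AddCommGroup D] [Module R D] [Coalgebra R D] [AddCommGroup E] [Module R E]
    [Coalgebra R E] [AddCommGroup F] [Module R F] [Coalgebra R F]
    {f g : C ⊗[R] (D ⊗[R] E) →ₗc[R] F}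
    (hfg : ∀ x y z, f (x ⊗ₜ (y ⊗ₜ z)) = g (x ⊗ₜ (y ⊗ₜ z))) : f = g := by
  refine CoalgHom.coe_linearMap_injective (TensorProduct.ext' fun x t => ?_)
  induction t with
  | zero => simp
  | add s t hs ht => simp only [TensorProduct.tmul_add, map_add, hs, ht]
  | tmul y z => exact hfg x y z

namespace IsCrossed

variable {act : WeakAction R H A} {σ σ' : H ⊗[R] H →ₗ[R] A} {i : A →ₐ[R] B} {j : H →ₗ[R] B}
  {π : B →ₗ[R] A}

lemma convComp_mul_convComp (h : IsCrossed act σ i j π) :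
    convComp (coalgFst R H H) (toConv j) * convComp (coalgSnd R H H) (toConv j) =
      convMap i (toConv σ) * convComp (Bialgebra.mulCoalgHom R H) (toConv j) := by
  ext x y
  exact (convComp_coalgFst_mul_convComp_coalgSnd (toConv j) (toConv j) x y).trans
    (h.mul_mul (x ⊗ₜ y))

/-- The map `c` preserves counits, so `π`, acting as `id ⊗ ε`, leaves `∑ x(z₁) ε(z₂)`. Identities in
`A` can therefore be read off from identities in `B`. -/
lemma proj_mul (h : IsCrossed act σ i j π) {C : Type*} [AddCommGroup C] [Module R C]
    [Coalgebra R C] (c : C →ₗc[R] H) (x : WithConv (C →ₗ[R] A)) (z : C) :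
    π ((convMap i x * convComp c (toConv j)) z) = x z := by
  have h₁ : ∀ t : C ⊗[R] C, π (LinearMap.mul' R B (TensorProduct.map (convMap i x).ofConv
      (convComp c (toConv j)).ofConv t)) =
      x (TensorProduct.rid R C ((Coalgebra.counit (R := R)).lTensor C t)) := by
    intro t
    induction t with
    | zero => simp
    | add x y hx hy => simp only [map_add, hx, hy]
    | tmul x y => simp [h.proj]
  refine (h₁ _).trans ?_
  simp

lemma mul_right_cancel (h : IsCrossed act σ i j π) {C : Type*} [AddCommGroup C] [Module R C]
    [Coalgebra R C] (c : C →ₗc[R] H) {x y : WithConv (C →ₗ[R] A)}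
    (hxy : convMap i x * convComp c (toConv j) = convMap i y * convComp c (toConv j)) : x = y := by
  ext z
  rw [← h.proj_mul c x, hxy, h.proj_mul c y]

/-- Normalisation of the cocycle is not an axiom: it follows by applying `π` to `j(k) j(1) = j(k)`.
-/
lemma cocycle_apply_one (h : IsCrossed act σ i j π) (k : H) :
    σ (k ⊗ₜ 1) = algebraMap R A (Coalgebra.counit k) := by
  have h₁ := h.proj_mul (Bialgebra.mulCoalgHom R H) (toConv σ) (k ⊗ₜ 1)
  rw [← h.convComp_mul_convComp, convComp_coalgFst_mul_convComp_coalgSnd] at h₁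
  change π (j k * j 1) = σ (k ⊗ₜ 1) at h₁
  have h₂ := h.proj 1 k
  rw [map_one, one_mul] at h₂
  rw [← h₁, h.apply_one, mul_one, h₂, Algebra.algebraMap_eq_smul_one]

lemma cocycle_one_apply (h : IsCrossed act σ i j π) (k : H) :
    σ (1 ⊗ₜ k) = algebraMap R A (Coalgebra.counit k) := by
  have h₁ := h.proj_mul (Bialgebra.mulCoalgHom R H) (toConv σ) (1 ⊗ₜ k)
  rw [← h.convComp_mul_convComp, convComp_coalgFst_mul_convComp_coalgSnd] at h₁
  change π (j 1 * j k) = σ (1 ⊗ₜ k) at h₁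
  have h₂ := h.proj 1 k
  rw [map_one, one_mul] at h₂
  rw [← h₁, h.apply_one, one_mul, h₂, Algebra.algebraMap_eq_smul_one]

lemma inverse_one_apply (h : IsCrossed act σ i j π) (hσ : IsConvInverse σ σ') (k : H) :
    σ' (1 ⊗ₜ k) = algebraMap R A (Coalgebra.counit k) := by
  have h₁ := LinearMap.congr_fun (congrArg ofConv hσ.1) (1 ⊗ₜ k)
  have h₂ : ∀ Y : H ⊗[R] H, LinearMap.mul' R A (TensorProduct.map σ σ'
      (TensorProduct.tensorTensorTensorComm R H H H H ((1 ⊗ₜ 1) ⊗ₜ Y))) =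
      σ' (1 ⊗ₜ TensorProduct.lid R H ((Coalgebra.counit (R := R)).rTensor H Y)) := by
    intro Y
    induction Y with
    | zero => simp
    | add x y hx hy => simp only [map_add, TensorProduct.tmul_add, hx, hy]
    | tmul x y => simp [h.cocycle_one_apply, Algebra.algebraMap_eq_smul_one]
  have h₃ : (toConv σ * toConv σ').ofConv (1 ⊗ₜ k) = LinearMap.mul' R A (TensorProduct.map σ σ'
      (TensorProduct.tensorTensorTensorComm R H H H H ((1 ⊗ₜ 1) ⊗ₜ Coalgebra.comul k))) := by
    change LinearMap.mul' R A (TensorProduct.map σ σ'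
      (TensorProduct.tensorTensorTensorComm R H H H H
        (Coalgebra.comul (R := R) (1 : H) ⊗ₜ Coalgebra.comul k))) = _
    rw [Bialgebra.comul_one, Algebra.TensorProduct.one_def]
  rw [h₃, h₂, Coalgebra.rTensor_counit_comul] at h₁
  simpa using h₁

variable (i j σ') in
/-- `T(l ⊗ m) = ∑ σ'(l₁ ⊗ m) j(l₂)`. -/
def preInverse : WithConv (H ⊗[R] H →ₗ[R] B) :=
  convMap i (toConv σ') * convComp (coalgFst R H H) (toConv j)

variable (i j σ') in
/-- The convolution inverse `k ↦ ∑ σ'(S(k₂) ⊗ k₃) j(S(k₁))` of `j`. -/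
def inverse : H →ₗ[R] B := (preInverse σ' i j).ofConv ∘ₗ antipodeComul R H

lemma convMap_inverse_mul (hσ : IsConvInverse σ σ') :
    convMap i (toConv σ') * convMap i (toConv σ) = 1 := by
  rw [← map_mul, hσ.2, map_one]

lemma preInverse_mul (h : IsCrossed act σ i j π) (hσ : IsConvInverse σ σ') :
    preInverse σ' i j * convComp (coalgSnd R H H) (toConv j) =
      convComp (Bialgebra.mulCoalgHom R H) (toConv j) := by
  rw [preInverse, mul_assoc, h.convComp_mul_convComp, ← mul_assoc, convMap_inverse_mul hσ, one_mul]

/-- By `preInverse_mul` the product is the value of `j ∘ mul` at `∑ S(k₁) ⊗ k₂`, namely `∑ j(S(k₁)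
k₂) = ε(k) 1`. This side does not need the cocycle condition. -/
lemma inverse_mul (h : IsCrossed act σ i j π) (hσ : IsConvInverse σ σ') :
    toConv (inverse σ' i j) * toConv j = 1 := by
  rw [inverse, ← mul_convComp_coalgSnd_antipodeComul, h.preInverse_mul hσ]
  ext k
  change j (LinearMap.mul' R H ((antipode R).rTensor H (Coalgebra.comul k))) = _
  rw [mul_antipode_rTensor_comul_apply, Algebra.algebraMap_eq_smul_one, map_smul, h.apply_one,
    ← Algebra.algebraMap_eq_smul_one]
  rfl

/-- `j(h) i(u(x)) = ∑ i(h₁ u(x)) j(h₂)`, as an identity in `Hom(H ⊗ C, B)`. -/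
lemma mul_convMap (h : IsCrossed act σ i j π) {C : Type*} [AddCommGroup C] [Module R C]
    [Coalgebra R C] (u : C →ₗ[R] A) : ∃ t : WithConv (H ⊗[R] C →ₗ[R] A),
    convComp (coalgFst R H C) (toConv j) * convComp (coalgSnd R H C) (convMap i (toConv u)) =
      convMap i t * convComp (coalgFst R H C) (toConv j) := by
  let actₗ : A →ₗ[R] H →ₗ[R] A :=
    { toFun := act.act
      map_add' := fun a b => by simp [WeakAction.act]
      map_smul' := fun r a => by simp [WeakAction.act] }
  refine ⟨toConv (TensorProduct.lift (actₗ ∘ₗ u).flip), ?_⟩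
  ext x y
  refine (convComp_coalgFst_mul_convComp_coalgSnd _ _ x y).trans ?_
  refine (h.mul_incl x (u y)).trans ?_
  refine Eq.trans ?_ (mul_convComp_coalgFst _ _ x y).symm
  change _ = LinearMap.mul' R B (TensorProduct.map _ _ (Coalgebra.comul x))
  congr 2

/-- `j(h) T(l ⊗ m) = ∑ σ(h₁ ⊗ l₁ m₁) T(h₂ l₂ ⊗ m₂)`. -/
lemma convComp_mul_preInverse (h : IsCrossed act σ i j π) (hσ : IsConvInverse σ σ') :
    convComp (coalgFst R H (H ⊗[R] H)) (toConv j) *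
        convComp (coalgSnd R H (H ⊗[R] H)) (preInverse σ' i j) =
      convComp (coalgMulRight R H) (convMap i (toConv σ)) *
        convComp (coalgMulLeft R H) (preInverse σ' i j) := by
  obtain ⟨t, ht⟩ := h.mul_convMap σ'
  let fst₃ := coalgFst R H (H ⊗[R] H)
  let snd₃ := coalgSnd R H (H ⊗[R] H)
  let c₁₂ : H ⊗[R] (H ⊗[R] H) →ₗc[R] H ⊗[R] H :=
    Coalgebra.TensorProduct.map (CoalgHom.id R H) (coalgFst R H H)
  let d := coalgMulRight R H
  let e := coalgMulLeft R H
  have e₁ : (coalgFst R H H).comp c₁₂ = fst₃ :=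
    coalgHom_ext_threefold fun x y z => by
      simp [c₁₂, fst₃, mul_smul]
  have e₂ : (coalgSnd R H H).comp c₁₂ = (coalgFst R H H).comp snd₃ :=
    coalgHom_ext_threefold fun x y z => by
      simpa [c₁₂, snd₃] using smul_comm _ _ _
  have e₃ : (coalgFst R H H).comp e = (Bialgebra.mulCoalgHom R H).comp c₁₂ :=
    coalgHom_ext_threefold fun x y z => by simp [c₁₂, e, coalgMulLeft_tmul]
  have e₄ : (coalgSnd R H H).comp e = (coalgSnd R H H).comp snd₃ :=
    coalgHom_ext_threefold fun x y z => by simp [snd₃, e, coalgMulLeft_tmul, mul_smul]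
  have e₅ : (coalgFst R H H).comp d = fst₃ :=
    coalgHom_ext_threefold fun x y z => by
      simpa [fst₃, d, coalgMulRight_tmul, mul_smul] using smul_comm _ _ _
  have e₆ : (coalgSnd R H H).comp d = (Bialgebra.mulCoalgHom R H).comp snd₃ :=
    coalgHom_ext_threefold fun x y z => by simp [snd₃, d, coalgMulRight_tmul]
  have e₇ : (Bialgebra.mulCoalgHom R H).comp e = (Bialgebra.mulCoalgHom R H).comp d :=
    coalgHom_ext_threefold fun x y z => by
      simp [d, e, coalgMulRight_tmul, coalgMulLeft_tmul, mul_assoc]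
  -- In three variables `h, l, m`, these expand `j(h) j(l)`, `j(l) j(m)`, `j(hl) j(m)` and `j(h)
  -- j(lm)`.
  have f₁ := congrArg (convComp c₁₂) h.convComp_mul_convComp
  have f₂ := congrArg (convComp snd₃) h.convComp_mul_convComp
  have f₃ := congrArg (convComp e) h.convComp_mul_convComp
  have f₄ := congrArg (convComp d) h.convComp_mul_convComp
  simp only [map_mul, convComp_convComp, convComp_convMap, e₁, e₂, e₃, e₄, e₅, e₆, e₇]
    at f₁ f₂ f₃ f₄ ht
  change convComp fst₃ (toConv j) * convMap i (convComp snd₃ (toConv σ')) =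
    convMap i t * convComp fst₃ (toConv j) at ht
  have hcancel : convMap i (convComp snd₃ (toConv σ')) * convMap i (convComp snd₃ (toConv σ)) =
      (1 : WithConv (H ⊗[R] (H ⊗[R] H) →ₗ[R] B)) := by
    rw [← map_mul, ← map_mul, hσ.2, map_one, map_one]
  have hcancel' : convComp e (toConv σ) * convComp e (toConv σ') = 1 := by
    rw [← map_mul, hσ.1, map_one]
  -- Here `t(h ⊗ l ⊗ m) = h σ'(l ⊗ m)`, so `key` is the twisted cocycle condition with one factor
  -- moved across by `σ'`. It comes from associativity of `j(h) j(l) j(m)` after cancelling `j` on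
  -- the right.
  have key : t * convComp c₁₂ (toConv σ) * convComp e (toConv σ) = convComp d (toConv σ) := by
    refine h.mul_right_cancel ((Bialgebra.mulCoalgHom R H).comp d) ?_
    rw [← f₄, map_mul, map_mul, mul_assoc, ← f₃, mul_assoc,
      ← mul_assoc (convMap i (convComp c₁₂ _)), ← f₁,
      mul_assoc, f₂, ← mul_assoc, ← ht, mul_assoc,
      ← mul_assoc (convMap i (convComp snd₃ (toConv σ'))), hcancel, one_mul]
  have key' : t * convComp c₁₂ (toConv σ) = convComp d (toConv σ) * convComp e (toConv σ') := by
    rw [← key, mul_assoc, hcancel', mul_one]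
  simp only [preInverse, map_mul, convComp_convComp, convComp_convMap]
  change convComp fst₃ _ * (convMap i (convComp snd₃ _) * convComp (_ : CoalgHom R _ _) _) =
    convMap i (convComp d _) * (convMap i (convComp e _) * convComp ((coalgFst R H H).comp e) _)
  rw [← mul_assoc, ht, e₃, mul_assoc, f₁, ← mul_assoc, ← map_mul, key', map_mul, mul_assoc]

/-- Put `∑ k₁ ⊗ S(k₂) ⊗ k₃` into `convComp_mul_preInverse`. The right side becomes `∑ σ(k₁ ⊗ 1) T(1
⊗ k₂)` with `T = preInverse σ' i j`, and both factors are trivial by normalisation. -/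
lemma mul_inverse (h : IsCrossed act σ i j π) (hσ : IsConvInverse σ σ') :
    toConv j * toConv (inverse σ' i j) = 1 := by
  have h₁ := convComp_coalgMulRight_mul_convComp_coalgMulLeft (convMap i (toConv σ))
    (preInverse σ' i j)
  rw [← h.convComp_mul_preInverse hσ] at h₁
  have h₂ : toConv ((convMap i (toConv σ)).ofConv ∘ₗ (TensorProduct.mk R H H).flip 1) = 1 := by
    ext k
    simp [h.cocycle_apply_one]
  have h₃ : toConv ((preInverse σ' i j).ofConv ∘ₗ TensorProduct.mk R H H 1) = 1 := by
    ext k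
    refine (mul_convComp_coalgFst _ _ 1 k).trans ?_
    change LinearMap.mul' R B (TensorProduct.map _ _ (Coalgebra.comul 1)) = _
    rw [Bialgebra.comul_one, Algebra.TensorProduct.one_def]
    simp [h.apply_one, h.inverse_one_apply hσ]
  rw [h₂, h₃, one_mul] at h₁
  rw [← h₁]
  ext k
  change LinearMap.mul' R B (TensorProduct.map j (inverse σ' i j) (Coalgebra.comul k)) =
    (convComp (coalgFst R H (H ⊗[R] H)) (toConv j) *
        convComp (coalgSnd R H (H ⊗[R] H)) (preInverse σ' i j))
      ((antipodeComul R H).lTensor H (Coalgebra.comul k))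
  generalize (Coalgebra.comul k : H ⊗[R] H) = z
  induction z with
  | zero => simp
  | add x y hx hy => simp only [map_add, hx, hy]
  | tmul x y =>
    rw [LinearMap.lTensor_tmul, convComp_coalgFst_mul_convComp_coalgSnd]
    rfl

end IsCrossed

end Cleft

/-! ### The crossed product as an instance of the abstract form. -/

section

variable {R : Type u} [CommRing R] {H : Type v} [Ring H] [HopfAlgebra R H]
variable {A : Type w} [Ring A] [Algebra R A]
variable {act : WeakAction R H A} {σ σ' : H ⊗[R] H →ₗ[R] A}

namespace CrossedProduct

instance [hσ : Fact (IsRightCrossedProduct act σ)] : Ring (CrossedProduct act σ) where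
  __ := (inferInstance : NonUnitalNonAssocRing (CrossedProduct act σ))
  one := tmul act σ 1 1
  one_mul := hσ.out.one_mul
  mul_one := hσ.out.mul_one
  mul_assoc := hσ.out.mul_assoc

instance [Fact (IsRightCrossedProduct act σ)] : Algebra R (CrossedProduct act σ) :=
  Algebra.ofModule smul_mul_assoc mul_smul_comm

variable [Fact (IsRightCrossedProduct act σ)]

lemma one_def : (1 : CrossedProduct act σ) = tmul act σ 1 1 := rfl

variable (act σ) in
/-- The inclusion `a ↦ a # 1`. -/
def incl : A →ₐ[R] CrossedProduct act σ :=
  AlgHom.ofLinearMap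
    { toFun := fun a => a • (1 : CrossedProduct act σ)
      map_add' := fun a b => add_smul a b _
      map_smul' := fun r a => smul_assoc r a _ }
    (one_smul A _)
    (fun a b => by
      change (a * b) • (1 : CrossedProduct act σ) = a • 1 * b • 1
      rw [smul_mul, one_mul, mul_smul])

lemma incl_mul (a : A) (x : CrossedProduct act σ) : incl act σ a * x = a • x := by
  change a • 1 * x = a • x
  rw [smul_mul, one_mul]

lemma incl_mul_tmulHom (a : A) (h : H) :
    incl act σ a * tmulHom act σ 1 h = tmul act σ a h := by
  rw [incl_mul, tmulHom_apply, smul_tmul', mul_one]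

lemma isCrossed : IsCrossed act σ (incl act σ) (tmulHom act σ 1)
    ((TensorProduct.rid R A).toLinearMap ∘ₗ (Coalgebra.counit (R := R)).lTensor A :
      A ⊗[R] H →ₗ[R] A) where
  apply_one := rfl
  mul_incl h a := by
    have h₁ : incl act σ a = tmul act σ a 1 := by
      rw [← mul_one (incl act σ a), one_def]; exact incl_mul_tmulHom a 1
    rw [h₁, tmulHom_apply, one_tmul_mul_tmul]
    generalize (Coalgebra.comul h : H ⊗[R] H) = z
    induction z with
    | zero => simp only [map_zero]; rfl
    | add x y hx hy => simp only [map_add, ← hx, ← hy]; rfl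
    | tmul x y =>
      have h₂ : cocycleMul σ (y ⊗ₜ[R] 1) = tmul act σ 1 y := by
        rw [← one_tmul_mul_one_tmul (act := act)]
        exact mul_one (tmul act σ 1 y)
      rw [TensorProduct.map_tmul, TensorProduct.map_tmul, mulLeftFactor_tmul, LinearMap.mul'_apply,
        LinearMap.comp_apply, LinearMap.comp_apply, AlgHom.toLinearMap_apply, incl_mul]
      exact congrArg (act.act a x • ·) h₂
  mul_mul z := by
    induction z with
    | zero => simp
    | add x y hx hy => simp only [map_add, hx, hy]
    | tmul x y =>
      rw [TensorProduct.map_tmul, LinearMap.mul'_apply, tmulHom_apply, tmulHom_apply,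
        one_tmul_mul_one_tmul, cocycleMul, LinearMap.comp_apply]
      generalize Coalgebra.comul (R := R) (x ⊗ₜ[R] y) = z
      induction z with
      | zero => simp only [map_zero]; rfl
      | add x y hx hy => simp only [map_add, ← hx, ← hy]; rfl
      | tmul x y => exact (incl_mul_tmulHom _ _).symm
  proj a h := by
    rw [incl_mul_tmulHom]
    change TensorProduct.rid R A ((Coalgebra.counit (R := R)).lTensor A (a ⊗ₜ h)) = _
    simp

end CrossedProduct

end

/-! ### The maps `crossMap` and `rconv`, and products with `1 # k` in terms of `φ`. -/

section

variable {R : Type u} [CommRing R] {H : Type v} [Ring H] [HopfAlgebra R H]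
variable {A : Type w} [Ring A] [Algebra R A]
variable {act : WeakAction R H A} {σ σ' : H ⊗[R] H →ₗ[R] A}

open HopfAlgebra

/-- For `X : H ⊗ A → Hom(H, A)` and `T : H → H ⊗ H`, `T k = ∑ t₁ ⊗ t₂`, the map
`x ⊗ y ↦ [k ↦ ∑ X(x ⊗ a)(t₁) ⊗ t₂ y]`. -/
def crossMap (X : H ⊗[R] A →ₗ[R] (H →ₗ[R] A)) (T : H →ₗ[R] H ⊗[R] H) (a : A) :
    H ⊗[R] H →ₗ[R] (H →ₗ[R] A ⊗[R] H) :=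
  TensorProduct.lift (LinearMap.mk₂ R
    (fun x y => TensorProduct.map (X (x ⊗ₜ a)) (LinearMap.mulRight R y) ∘ₗ T)
    (fun x₁ x₂ y => by
      simp [TensorProduct.add_tmul, TensorProduct.map_add_left, LinearMap.add_comp])
    (fun r x y => by
      simp [← TensorProduct.smul_tmul', TensorProduct.map_smul_left, LinearMap.smul_comp])
    (fun x y₁ y₂ => by
      have : LinearMap.mulRight R (y₁ + y₂) = LinearMap.mulRight R y₁ + LinearMap.mulRight R y₂ := by
        ext; simp [mul_add]
      simp [this, TensorProduct.map_add_right, LinearMap.add_comp])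
    (fun r x y => by
      have : LinearMap.mulRight R (r • y) = r • LinearMap.mulRight R y := by ext; simp
      simp [this, TensorProduct.map_smul_right, LinearMap.smul_comp]))

@[simp] lemma crossMap_tmul (X : H ⊗[R] A →ₗ[R] (H →ₗ[R] A)) (T : H →ₗ[R] H ⊗[R] H) (a : A)
    (x y k : H) : crossMap X T a (x ⊗ₜ y) k =
      TensorProduct.map (X (x ⊗ₜ a)) (LinearMap.mulRight R y) (T k) := rfl

/-- `(1 ⊗ k₁) ∑ X(x ⊗ a)(k₄) ⊗ S(k₃) k₅ y = ∑ X(x ⊗ a)(k₁) ⊗ k₂ y`. -/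
lemma includeRight_mul_crossMap (X : H ⊗[R] A →ₗ[R] (H →ₗ[R] A)) (a : A) (z : H ⊗[R] H) :
    toConv (Algebra.TensorProduct.includeRight : H →ₐ[R] A ⊗[R] H).toLinearMap *
      toConv (crossMap X (twistedComul R H) a z) = toConv (crossMap X Coalgebra.comul a z) := by
  ext k
  change LinearMap.mul' R _ (TensorProduct.map _ (crossMap X (twistedComul R H) a z)
    (Coalgebra.comul k)) = crossMap X Coalgebra.comul a z k
  induction z with
  | zero => simp
  | add x y hx hy =>
    simp only [map_add, LinearMap.add_apply, TensorProduct.map_add_right, hx, hy]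
  | tmul x y =>
    have h := congrArg (TensorProduct.map (X (x ⊗ₜ a)) (LinearMap.mulRight R y))
      (LinearMap.congr_fun (congrArg ofConv (includeRight_mul_twistedComul (R := R) (H := H))) k)
    refine Eq.trans ?_ h
    change _ = TensorProduct.map (X (x ⊗ₜ a)) (LinearMap.mulRight R y)
      (LinearMap.mul' R _ (TensorProduct.map _ (twistedComul R H) (Coalgebra.comul k)))
    generalize (Coalgebra.comul k : H ⊗[R] H) = z
    induction z with
    | zero => simp
    | add x y hx hy => simp only [map_add, hx, hy]
    | tmul k l =>
      simp only [TensorProduct.map_tmul, LinearMap.mul'_apply, crossMap_tmul]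
      generalize twistedComul R H l = z
      induction z with
      | zero => simp
      | add x y hx hy => simp only [map_add, mul_add, hx, hy]
      | tmul x y => simp [mul_assoc]

/-- `∑ F(k₁) f(k₂)`. -/
def rconv {M : Type*} [AddCommGroup M] [Module R M] (F : H →ₗ[R] M) (f : Module.Dual R H) :
    H →ₗ[R] M :=
  (TensorProduct.rid R M).toLinearMap ∘ₗ TensorProduct.map F f ∘ₗ Coalgebra.comul

section rconv

variable {M N : Type*} [AddCommGroup M] [Module R M] [AddCommGroup N] [Module R N]

lemma rconv_apply (F : H →ₗ[R] M) (f : Module.Dual R H) (k : H) :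
    rconv F f k = TensorProduct.rid R M (TensorProduct.map F f (Coalgebra.comul k)) := rfl

lemma rconv_add (F G : H →ₗ[R] M) (f : Module.Dual R H) :
    rconv (F + G) f = rconv F f + rconv G f := by
  ext; simp [rconv_apply, TensorProduct.map_add_left]

lemma rconv_zero (f : Module.Dual R H) : rconv (0 : H →ₗ[R] M) f = 0 := by
  ext; simp [rconv_apply]

lemma comp_rconv (g : M →ₗ[R] N) (F : H →ₗ[R] M) (f : Module.Dual R H) :
    g ∘ₗ rconv F f = rconv (g ∘ₗ F) f := by
  ext k
  simp only [rconv_apply, LinearMap.comp_apply]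
  hopf_tensor_induction (Coalgebra.comul (R := R) k) with x y
  simp

lemma rconv_smulRight (f g : Module.Dual R H) (m : M) :
    rconv (f.smulRight m) g = (conv f g).smulRight m := by
  ext k
  change TensorProduct.rid R M (TensorProduct.map (f.smulRight m) g (Coalgebra.comul k)) =
    LinearMap.mul' R R (TensorProduct.map f g (Coalgebra.comul k)) • m
  generalize (Coalgebra.comul k : H ⊗[R] H) = z
  induction z with
  | zero => simp
  | add x y hx hy => simp only [map_add, add_smul, hx, hy]
  | tmul x y => simp [mul_smul, smul_comm (f x)]

lemma toConv_rconv {B : Type*} [Ring B] [Algebra R B] (F : H →ₗ[R] B) (f : Module.Dual R H) :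
    toConv (rconv F f) = toConv F * toConv (Algebra.linearMap R B ∘ₗ f) := by
  ext k
  change TensorProduct.rid R B (TensorProduct.map F f (Coalgebra.comul k)) =
    LinearMap.mul' R B (TensorProduct.map F (Algebra.linearMap R B ∘ₗ f) (Coalgebra.comul k))
  generalize (Coalgebra.comul k : H ⊗[R] H) = z
  induction z with
  | zero => simp
  | add x y hx hy => simp only [map_add, hx, hy]
  | tmul x y => simp [Algebra.algebraMap_eq_smul_one]

/-- `rconv` by `f` is right convolution with a scalar-valued map, so this is associativity of
convolution. -/
lemma mul_rconv {B : Type*} [Ring B] [Algebra R B] (F : WithConv (H →ₗ[R] B)) (G : H →ₗ[R] B)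
    (f : Module.Dual R H) : F * toConv (rconv G f) = toConv (rconv (F * toConv G).ofConv f) := by
  rw [toConv_rconv, toConv_rconv, mul_assoc]

end rconv

/-- `(1 # k)(a # h) = ∑ φ(h₁ ⊗ a)(k₁) # k₂ h₂`. -/
lemma one_tmul_mul_tmul_eq_crossMap_phi (a : A) (h k : H) :
    CrossedProduct.tmul act σ 1 k * CrossedProduct.tmul act σ a h =
      crossMap (phi act σ) Coalgebra.comul a (Coalgebra.comul h) k := by
  have h₁ : ∀ w : H ⊗[R] H, CrossedProduct.mulLeftFactor (TensorProduct.map (act.act a)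
      (TensorProduct.map σ (LinearMap.mul' R H) ∘ₗ
        (TensorProduct.tensorTensorTensorComm R H H H H).toLinearMap ∘ₗ
        (TensorProduct.mk R (H ⊗[R] H) (H ⊗[R] H)).flip w ∘ₗ Coalgebra.comul)
        (Coalgebra.comul k)) =
      crossMap (phi act σ) Coalgebra.comul a w k := by
    intro w
    induction w with
    | zero => simp
    | add x y hx hy =>
      simp only [map_add, LinearMap.add_apply, TensorProduct.map_add_right, LinearMap.comp_add,
        LinearMap.add_comp, hx, hy]
    | tmul x y =>
      have h := congrArg (CrossedProduct.mulLeftFactor ∘ₗ TensorProduct.map (act.act a)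
        (TensorProduct.map (σ ∘ₗ (TensorProduct.mk R H H).flip x) (LinearMap.mulRight R y)))
        (Coalgebra.coassoc_apply (R := R) k)
      refine Eq.trans ?_ (h.symm.trans ?_)
      · generalize (Coalgebra.comul k : H ⊗[R] H) = z
        induction z with
        | zero => simp
        | add x y hx hy => simp only [map_add, hx, hy]
        | tmul k l =>
          simp only [LinearMap.lTensor_tmul, TensorProduct.map_tmul, LinearMap.comp_apply]
          congr 2
          generalize (Coalgebra.comul l : H ⊗[R] H) = z
          induction z with
          | zero => simp
          | add x y hx hy => simp only [map_add, hx, hy]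
          | tmul k l => simp
      · rw [crossMap_tmul]
        generalize (Coalgebra.comul k : H ⊗[R] H) = z
        induction z with
        | zero => simp
        | add x y hx hy => simp only [map_add, hx, hy]
        | tmul k l =>
          simp only [LinearMap.rTensor_tmul, TensorProduct.map_tmul]
          change _ = LinearMap.mul' R A (TensorProduct.map (act.act a)
            (σ ∘ₗ (TensorProduct.mk R H H).flip x) (Coalgebra.comul k)) ⊗ₜ _
          generalize (Coalgebra.comul k : H ⊗[R] H) = z
          induction z with
          | zero => simp
          | add x y hx hy => simp only [map_add, TensorProduct.add_tmul, hx, hy]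
          | tmul k l => simp [TensorProduct.smul_tmul']
  rw [CrossedProduct.one_tmul_mul_tmul, ← h₁]
  rfl

end

/-! ### Convolution with the inverse of `j`, in terms of `ψ`. -/

section

variable {R : Type u} [CommRing R] {H : Type v} [Ring H] [HopfAlgebra R H]
variable {A : Type w} [Ring A] [Algebra R A] {B : Type*} [Ring B] [Algebra R B]

open HopfAlgebra

/-- The coproduct of `∑ S(k₁) ⊗ k₂` is `∑ (S(k₂) ⊗ k₃) ⊗ (S(k₁) ⊗ k₄)`. -/
lemma comul_antipodeComul (k : H) :
    Coalgebra.comul (R := R) (antipodeComul R H k) =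
      TensorProduct.map (antipodeComul R H) ((antipode R).rTensor H)
        (TensorProduct.leftComm R H H H (comul₃ R H k)) := by
  let inl : H ⊗[R] H →ₐ[R] (H ⊗[R] H) ⊗[R] (H ⊗[R] H) := Algebra.TensorProduct.includeLeft
  let inr : H ⊗[R] H →ₐ[R] (H ⊗[R] H) ⊗[R] (H ⊗[R] H) := Algebra.TensorProduct.includeRight
  let ι₁ : H →ₐ[R] (H ⊗[R] H) ⊗[R] (H ⊗[R] H) := inl.comp Algebra.TensorProduct.includeLeft
  let ι₂ : H →ₐ[R] (H ⊗[R] H) ⊗[R] (H ⊗[R] H) := inl.comp Algebra.TensorProduct.includeRight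
  let ι₃ : H →ₐ[R] (H ⊗[R] H) ⊗[R] (H ⊗[R] H) := inr.comp Algebra.TensorProduct.includeLeft
  let ι₄ : H →ₐ[R] (H ⊗[R] H) ⊗[R] (H ⊗[R] H) := inr.comp Algebra.TensorProduct.includeRight
  let u : H →ₐ[R] (H ⊗[R] H) ⊗[R] (H ⊗[R] H) := (Algebra.TensorProduct.map
    Algebra.TensorProduct.includeLeft Algebra.TensorProduct.includeLeft).comp
      (Bialgebra.comulAlgHom R H)
  let v : H →ₐ[R] (H ⊗[R] H) ⊗[R] (H ⊗[R] H) := (Algebra.TensorProduct.map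
    Algebra.TensorProduct.includeRight Algebra.TensorProduct.includeRight).comp
      (Bialgebra.comulAlgHom R H)
  have hu : toConv u.toLinearMap = toConv ι₁.toLinearMap * toConv ι₃.toLinearMap := by
    ext k
    change Algebra.TensorProduct.map _ _ (Coalgebra.comul (R := R) k) =
      LinearMap.mul' R _ (TensorProduct.map ι₁.toLinearMap ι₃.toLinearMap (Coalgebra.comul k))
    generalize (Coalgebra.comul k : H ⊗[R] H) = z
    induction z with
    | zero => simp
    | add x y hx hy => simp only [map_add, hx, hy]
    | tmul x y => simp [ι₁, ι₃, inl, inr]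
  have hv : toConv v.toLinearMap = toConv ι₂.toLinearMap * toConv ι₄.toLinearMap := by
    ext k
    change Algebra.TensorProduct.map _ _ (Coalgebra.comul (R := R) k) =
      LinearMap.mul' R _ (TensorProduct.map ι₂.toLinearMap ι₄.toLinearMap (Coalgebra.comul k))
    generalize (Coalgebra.comul k : H ⊗[R] H) = z
    induction z with
    | zero => simp
    | add x y hx hy => simp only [map_add, hx, hy]
    | tmul x y => simp [ι₂, ι₄, inl, inr]
  have h₁ : toConv (Coalgebra.comul (R := R) ∘ₗ antipodeComul R H) =
      toConv (u.toLinearMap ∘ₗ antipode R) * toConv v.toLinearMap := by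
    ext k
    change Coalgebra.comul (R := R) ((antipode R).rTensor H (Coalgebra.comul k)) =
      LinearMap.mul' R _ (TensorProduct.map (u.toLinearMap ∘ₗ antipode R) v.toLinearMap
        (Coalgebra.comul k))
    generalize (Coalgebra.comul k : H ⊗[R] H) = z
    induction z with
    | zero => simp
    | add x y hx hy => simp only [map_add, hx, hy]
    | tmul x y =>
      simp only [LinearMap.rTensor_tmul, TensorProduct.map_tmul, LinearMap.comp_apply, u, v,
        TensorProduct.comul_tmul, AlgHom.toLinearMap_apply, AlgHom.comp_apply,
        Bialgebra.comulAlgHom_apply, LinearMap.mul'_apply]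
      generalize (Coalgebra.comul (antipode R x) : H ⊗[R] H) = z
      generalize (Coalgebra.comul y : H ⊗[R] H) = z'
      induction z with
      | zero => simp
      | add x y hx hy => simp only [map_add, TensorProduct.add_tmul, add_mul, hx, hy]
      | tmul x₁ x₂ =>
        induction z' with
        | zero => simp
        | add x y hx hy => simp only [map_add, TensorProduct.tmul_add, mul_add, hx, hy]
        | tmul y₁ y₂ => simp
  have h₂ : toConv (inl.toLinearMap ∘ₗ antipodeComul R H) =
      toConv (ι₁.toLinearMap ∘ₗ antipode R) * toConv ι₂.toLinearMap := by
    ext k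
    change inl ((antipode R).rTensor H (Coalgebra.comul k)) =
      LinearMap.mul' R _ (TensorProduct.map (ι₁.toLinearMap ∘ₗ antipode R) ι₂.toLinearMap
        (Coalgebra.comul k))
    generalize (Coalgebra.comul k : H ⊗[R] H) = z
    induction z with
    | zero => simp
    | add x y hx hy => simp only [map_add, hx, hy]
    | tmul x y => simp [ι₁, ι₂, inl]
  -- The coproduct becomes `(ι₃ ∘ S) ⋆ (ι₁ ∘ S) ⋆ ι₂ ⋆ ι₄`; the two inner factors combine to `∑
  -- S(k₂) ⊗ k₃` in the first tensor square.
  rw [algHom_comp_antipode_of_eq_mul hu, hv, mul_assoc, ← mul_assoc (toConv (ι₁.toLinearMap ∘ₗ _)),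
    ← h₂] at h₁
  refine (LinearMap.congr_fun (congrArg ofConv h₁) k).trans ?_
  change LinearMap.mul' R _ (TensorProduct.map (ι₃.toLinearMap ∘ₗ antipode R)
    (LinearMap.mul' R _ ∘ₗ TensorProduct.map (inl.toLinearMap ∘ₗ antipodeComul R H)
      ι₄.toLinearMap ∘ₗ Coalgebra.comul) (Coalgebra.comul k)) =
    TensorProduct.map (antipodeComul R H) ((antipode R).rTensor H)
        (TensorProduct.leftComm R H H H ((Coalgebra.comul (R := R)).lTensor H (Coalgebra.comul k)))
  generalize (Coalgebra.comul k : H ⊗[R] H) = z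
  induction z with
  | zero => simp
  | add x y hx hy => simp only [map_add, hx, hy]
  | tmul x y =>
    simp only [LinearMap.lTensor_tmul, TensorProduct.map_tmul, LinearMap.comp_apply]
    generalize (Coalgebra.comul y : H ⊗[R] H) = z
    induction z with
    | zero => simp
    | add x y hx hy => simp only [map_add, TensorProduct.tmul_add, hx, hy]
    | tmul y z => simp [ι₃, ι₄, inl, inr]

/-- `∑ F(S(k₂) ⊗ k₃) G(S(k₁) ⊗ k₄)` is the value of `F ⋆ G` at `∑ S(k₁) ⊗ k₂`. -/
lemma convMul_antipodeComul (F G : WithConv (H ⊗[R] H →ₗ[R] B)) (k : H) :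
    (F * G) (antipodeComul R H k) = LinearMap.mul' R B (TensorProduct.map
      (F.ofConv ∘ₗ antipodeComul R H) (G.ofConv ∘ₗ (antipode R).rTensor H)
        (TensorProduct.leftComm R H H H (comul₃ R H k))) := by
  change LinearMap.mul' R B (TensorProduct.map F.ofConv G.ofConv (Coalgebra.comul _)) = _
  rw [comul_antipodeComul, ← LinearMap.comp_apply (TensorProduct.map F.ofConv G.ofConv),
    ← TensorProduct.map_comp]

/-- `∑ F(S(k₂) ⊗ k₃) g(S(k₁) k₄)`, in terms of the twisted coproduct. -/
lemma mul_convComp_mulCoalgHom_antipodeComul (F : WithConv (H ⊗[R] H →ₗ[R] B))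
    (g : WithConv (H →ₗ[R] B)) (k : H) :
    (F * convComp (Bialgebra.mulCoalgHom R H) g) (antipodeComul R H k) =
      LinearMap.mul' R B (TensorProduct.map (F.ofConv ∘ₗ antipodeComul R H) g.ofConv
        (twistedComul R H k)) := by
  rw [convMul_antipodeComul]
  simp only [twistedComul, LinearMap.comp_apply, LinearEquiv.coe_coe]
  generalize TensorProduct.leftComm R H H H (comul₃ R H k) = z
  induction z with
  | zero => simp
  | add x y hx hy => simp only [map_add, hx, hy]
  | tmul x y => simp

variable {act : WeakAction R H A} {σ σ' : H ⊗[R] H →ₗ[R] A}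

/-- The five-leg formula for `ψ` is a threefold convolution product on `H ⊗ H` evaluated at `∑ S(k₁)
⊗ k₂`: iterated coproducts of that element nest the legs as `S(k₃) ⊗ k₄`, `S(k₂)`, `S(k₁) ⊗ k₅`. -/
lemma psi_apply (a : A) (h k : H) : psi act σ σ' (h ⊗ₜ a) k =
    (toConv σ' * convComp (coalgFst R H H) (toConv (act.act a)) *
      toConv (σ ∘ₗ (LinearMap.mulRight R h).lTensor H)) (antipodeComul R H k) := by
  rw [convMul_antipodeComul]
  have h₁ : (toConv σ' * convComp (coalgFst R H H) (toConv (act.act a))).ofConv ∘ₗ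
      antipodeComul R H = psiInner act σ' a := by
    ext k
    refine (mul_convComp_coalgFst_antipodeComul (toConv σ') (toConv (act.act a)) k).trans ?_
    change _ = LinearMap.mul' R A (TensorProduct.comm R A A (TensorProduct.map _ _
      ((Coalgebra.comul (R := R)).lTensor H (Coalgebra.comul k))))
    generalize (Coalgebra.comul k : H ⊗[R] H) = z
    induction z with
    | zero => simp
    | add x y hx hy => simp only [map_add, hx, hy]
    | tmul x y => simp [antipodeComul]
  rw [h₁]
  change LinearMap.mul' R A (TensorProduct.map _ _ (TensorProduct.leftComm R H H H _)) = _
  congr 3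
  ext x y
  simp

variable [Fact (IsRightCrossedProduct act σ)]

open CrossedProduct

/-- `∑ j⁻¹(k₁) (a # k₂ h) = ∑ ψ(h₁ ⊗ a)(k₃) # S(k₂) k₄ h₂`, where `j(k) = 1 # k`. -/
lemma inverse_mul_tmulHom_comp_mulRight (a : A) (h k : H) :
    (toConv (IsCrossed.inverse σ' (incl act σ) (tmulHom act σ 1)) *
      toConv (tmulHom act σ a ∘ₗ LinearMap.mulRight R h)) k =
        crossMap (psi act σ σ') (twistedComul R H) a (Coalgebra.comul h) k := by
  set i := incl act σ
  set j := tmulHom act σ 1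
  have hc : IsCrossed act σ i j _ := CrossedProduct.isCrossed
  let f := convMap i (toConv σ') * convComp (coalgFst R H H) (convMap i (toConv (act.act a)))
  -- For `w = p ⊗ q`, `K w` is `x ⊗ y ↦ ∑ σ(x₁ ⊗ y₁ p) # x₂ y₂ q`; at `w = Δ(h)` it is `j(x) j(y
  -- h)`. It is stated for arbitrary `w` to allow induction.
  let K : H ⊗[R] H → (H ⊗[R] H →ₗ[R] CrossedProduct act σ) := fun w =>
    LinearMap.mul' R _ ∘ₗ TensorProduct.map (i.toLinearMap ∘ₗ σ) (j ∘ₗ LinearMap.mul' R H) ∘ₗ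
      LinearMap.mulRight R (TensorProduct.tensorTensorTensorComm R H H H H ((1 ⊗ₜ 1) ⊗ₜ w)) ∘ₗ
        Coalgebra.comul
  have h₁ : IsCrossed.preInverse σ' i j *
      convComp (coalgSnd R H H) (toConv (tmulHom act σ a ∘ₗ LinearMap.mulRight R h)) =
      f * toConv (K (Coalgebra.comul h)) := by
    have h₂ : convComp (coalgFst R H H) (toConv j) *
        convComp (coalgSnd R H H) (toConv (tmulHom act σ a ∘ₗ LinearMap.mulRight R h)) =
        convComp (coalgFst R H H) (convMap i (toConv (act.act a)) * toConv j) *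
          convComp (coalgSnd R H H) (toConv (j ∘ₗ LinearMap.mulRight R h)) := by
      ext x y
      refine (convComp_coalgFst_mul_convComp_coalgSnd _ _ x y).trans
        (Eq.trans ?_ (convComp_coalgFst_mul_convComp_coalgSnd _ _ x y).symm)
      change j x * tmul act σ a (y * h) = LinearMap.mul' R _ (TensorProduct.map
        (i.toLinearMap ∘ₗ act.act a) j (Coalgebra.comul x)) * j (y * h)
      rw [← hc.mul_incl, mul_assoc, ← incl_mul_tmulHom]
    have h₃ : convComp (coalgFst R H H) (toConv j) *
          convComp (coalgSnd R H H) (toConv (j ∘ₗ LinearMap.mulRight R h)) =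
        toConv (K (Coalgebra.comul h)) := by
      ext x y
      refine (convComp_coalgFst_mul_convComp_coalgSnd _ _ x y).trans
        ((hc.mul_mul (x ⊗ₜ (y * h))).trans ?_)
      have h₄ : Coalgebra.comul (R := R) (x ⊗ₜ[R] (y * h)) = Coalgebra.comul (R := R) (x ⊗ₜ[R] y) *
          TensorProduct.tensorTensorTensorComm R H H H H ((1 ⊗ₜ 1) ⊗ₜ Coalgebra.comul h) := by
        have h₅ : TensorProduct.tensorTensorTensorComm R H H H H ((1 ⊗ₜ 1) ⊗ₜ Coalgebra.comul h) =
            Coalgebra.comul (R := R) ((1 : H) ⊗ₜ[R] h) := by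
          rw [TensorProduct.comul_tmul, Bialgebra.comul_one, Algebra.TensorProduct.one_def]
          rfl
        rw [h₅, ← Bialgebra.comul_mul, Algebra.TensorProduct.tmul_mul_tmul, mul_one]
      rw [h₄]
      rfl
    rw [IsCrossed.preInverse, mul_assoc, h₂, map_mul, mul_assoc, h₃, ← mul_assoc]
  have h₂ : ∀ w, (f * toConv (K w)) (antipodeComul R H k) =
      (crossMap (psi act σ σ') (twistedComul R H) a w k : A ⊗[R] H) := by
    intro w
    induction w with
    | zero =>
      have : K 0 = 0 := by simp [K]
      rw [this]
      simp
      rfl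
    | add x y hx hy =>
      have : K (x + y) = K x + K y := by
        simp only [K, TensorProduct.tmul_add, map_add]
        ext; simp [mul_add]
      rw [this, map_add, LinearMap.add_apply, ← hx, ← hy]
      change (f * (toConv (K x) + toConv (K y))) _ = _
      rw [mul_add]
      rfl
    | tmul p q =>
      have h₃ : toConv (K (p ⊗ₜ q)) =
          convMap i (toConv (σ ∘ₗ (LinearMap.mulRight R p).lTensor H)) *
            convComp (Bialgebra.mulCoalgHom R H) (toConv (j ∘ₗ LinearMap.mulRight R q)) := by
        ext x y
        change LinearMap.mul' R _ (TensorProduct.map _ _ (Coalgebra.comul (R := R) (x ⊗ₜ[R] y) * _)) =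
          LinearMap.mul' R _ (TensorProduct.map _ _ (Coalgebra.comul (R := R) (x ⊗ₜ[R] y)))
        generalize Coalgebra.comul (R := R) (x ⊗ₜ[R] y) = z
        induction z with
        | zero => simp
        | add x y hx hy => simp only [add_mul, map_add, hx, hy]
        | tmul x y =>
          induction x with
          | zero => simp
          | add x y hx hy => simp only [add_mul, map_add, TensorProduct.add_tmul, hx, hy]
          | tmul x₁ x₂ =>
            induction y with
            | zero => simp
            | add x y hx hy => simp only [add_mul, map_add, TensorProduct.tmul_add, hx, hy]
            | tmul y₁ y₂ => simp [mul_assoc]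
      rw [h₃, ← mul_assoc]
      have h₄ : f * convMap i (toConv (σ ∘ₗ (LinearMap.mulRight R p).lTensor H)) =
          convMap i (toConv σ' * convComp (coalgFst R H H) (toConv (act.act a)) *
            toConv (σ ∘ₗ (LinearMap.mulRight R p).lTensor H)) := by
        rw [map_mul, map_mul]
        rfl
      rw [h₄, mul_convComp_mulCoalgHom_antipodeComul, crossMap_tmul]
      generalize twistedComul R H k = z
      induction z with
      | zero => simp only [map_zero]; rfl
      | add x y hx hy => simp only [map_add, hx, hy]; rfl
      | tmul x y =>
        rw [TensorProduct.map_tmul, TensorProduct.map_tmul, LinearMap.mul'_apply, psi_apply]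
        exact incl_mul_tmulHom _ _
  rw [← h₂, ← h₁, IsCrossed.inverse, ← mul_convComp_coalgSnd_antipodeComul]
  rfl

end

/-! ### Membership in the image of `α` through `ω`. -/

section

variable {R : Type u} [CommRing R] {H : Type v} [Ring H] [HopfAlgebra R H]
variable {A : Type w} [Ring A] [Algebra R A]

/-- The dual of a locally projective module separates its elements. -/
lemma LocallyProjective.eq_of_forall_dual {W : Type v} [AddCommGroup W] [Module R W]
    (hW : LocallyProjective R W) {x y : W} (h : ∀ p : Module.Dual R W, p x = p y) : x = y := by
  have h₁ := hW.alpha_injective R (a₁ := 1 ⊗ₜ x) (a₂ := 1 ⊗ₜ y) (by ext p; simp [h])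
  simpa using congrArg (TensorProduct.lid R W) h₁

/-- For `g` with `ω(g) = ∑ hᵢ ⊗ uᵢ` in `H ⊗ U`, one has `∑ g(k₂) S(k₁) k₃ = ∑ uᵢ(k) hᵢ`. -/
lemma exists_of_mem_omegaPreimage (hH : LocallyProjective R H)
    {U : Submodule R (Module.Dual R H)} {g : Module.Dual R H} (hg : g ∈ omegaPreimage hH U) :
    ∃ Ω : H ⊗[R] U, TensorProduct.lid R H ∘ₗ g.rTensor H ∘ₗ twistedComul R H =
      alpha (subPairing U) H Ω := by
  obtain ⟨⟨g, hg⟩, ⟨Ω, hΩ⟩, rfl⟩ := hg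
  refine ⟨Ω, ?_⟩
  have h₁ : alphaRight R H _ (U.subtype.lTensor H Ω) = twistedAction R H g := by
    rw [hΩ]
    exact congrArg Subtype.val (LinearEquiv.apply_symm_apply
      (LinearEquiv.ofInjective (alphaRight R H _) (alphaRight_injective hH _)) _)
  ext k
  refine hH.eq_of_forall_dual fun p => ?_
  have h₂ : LinearMap.mul' R R (TensorProduct.map g p (twistedComul R H k)) =
      p (TensorProduct.lid R H (g.rTensor H (twistedComul R H k))) := by
    generalize twistedComul R H k = z
    induction z with
    | zero => simp
    | add x y hx hy => simp only [map_add, hx, hy]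
    | tmul x y => simp
  -- Paired with `p`, the claim is the defining property of `ω(g)` for the twisted action.
  refine h₂.symm.trans ((LinearMap.congr_fun (LinearMap.congr_fun h₁ p) k).symm.trans ?_)
  clear h₁ hΩ
  induction Ω with
  | zero => simp
  | add x y hx hy => simp only [map_add, LinearMap.add_apply, hx, hy]
  | tmul x y => simp [alphaRight, subPairing, mul_comm]

lemma rconv_alpha_mem {M : Type*} [AddCommGroup M] [Module R M] (U : LeftModuleSubalgebra R H)
    (t : M ⊗[R] U.toSubmodule) {f : Module.Dual R H} (hf : f ∈ U.toSubmodule) :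
    rconv (alpha (subPairing U.toSubmodule) M t) f ∈
      LinearMap.range (alpha (subPairing U.toSubmodule) M) := by
  induction t with
  | zero => rw [map_zero, rconv_zero]; exact zero_mem _
  | add x y hx hy => rw [map_add, rconv_add]; exact add_mem hx hy
  | tmul m u =>
    refine ⟨m ⊗ₜ ⟨conv u.1 f, U.conv_mem' u.2 hf⟩, ?_⟩
    refine Eq.trans ?_ (rconv_smulRight u.1 f m).symm
    ext k; simp [subPairing]

/-- If `X(x ⊗ a) ∈ J(A ⊗ ω⁻¹(H ⊗ U))`, then `k ↦ ∑ X(x ⊗ a)(k₂) ⊗ S(k₁) k₃ y` lies in the image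
of `(A ⊗ H) ⊗ U`. -/
lemma crossMap_twistedComul_mem (hH : LocallyProjective R H) {U : Submodule R (Module.Dual R H)}
    {X : H ⊗[R] A →ₗ[R] (H →ₗ[R] A)}
    (hX : LinearMap.range X ≤ LinearMap.range (alpha (subPairing (omegaPreimage hH U)) A))
    (a : A) (z : H ⊗[R] H) : crossMap X (twistedComul R H) a z ∈
      LinearMap.range (alpha (subPairing U) (A ⊗[R] H)) := by
  induction z with
  | zero => rw [map_zero]; exact zero_mem _
  | add x y hx hy => rw [map_add]; exact add_mem hx hy
  | tmul x y =>
    obtain ⟨t, ht⟩ := hX ⟨x ⊗ₜ a, rfl⟩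
    have h₁ : crossMap X (twistedComul R H) a (x ⊗ₜ y) =
        TensorProduct.map (X (x ⊗ₜ a)) (LinearMap.mulRight R y) ∘ₗ twistedComul R H := rfl
    rw [h₁, ← ht]
    clear ht h₁
    induction t with
    | zero => rw [map_zero, TensorProduct.map_zero_left, LinearMap.zero_comp]; exact zero_mem _
    | add x y hx hy =>
      rw [map_add, TensorProduct.map_add_left, LinearMap.add_comp]; exact add_mem hx hy
    | tmul b g =>
      -- With `Ω = ∑ hᵢ ⊗ uᵢ`, the map `k ↦ ∑ g(k₂) b ⊗ S(k₁) k₃ y` becomes `k ↦ ∑ uᵢ(k) b ⊗ hᵢ y`.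
      obtain ⟨Ω, hΩ⟩ := exists_of_mem_omegaPreimage hH g.2
      have h₂ : TensorProduct.map (alpha (subPairing (omegaPreimage hH U)) A (b ⊗ₜ g))
          (LinearMap.mulRight R y) ∘ₗ twistedComul R H =
          (TensorProduct.mk R A H b ∘ₗ LinearMap.mulRight R y) ∘ₗ alpha (subPairing U) H Ω := by
        rw [← hΩ]
        ext k
        simp only [LinearMap.comp_apply, LinearEquiv.coe_coe]
        generalize twistedComul R H k = z
        induction z with
        | zero => simp
        | add x y hx hy => simp only [map_add, hx, hy]
        | tmul x y => simp [subPairing, TensorProduct.smul_tmul']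
      rw [h₂]
      clear hΩ h₂
      refine ⟨(TensorProduct.mk R A H b ∘ₗ LinearMap.mulRight R y).rTensor U Ω, ?_⟩
      induction Ω with
      | zero => simp
      | add x y hx hy => simp only [map_add, hx, hy, LinearMap.comp_add]
      | tmul x u => ext k; simp [subPairing, TensorProduct.smul_tmul']

lemma rconv_crossMap_twistedComul_mem (hH : LocallyProjective R H) (U : LeftModuleSubalgebra R H)
    {X : H ⊗[R] A →ₗ[R] (H →ₗ[R] A)} (hX : LinearMap.range X ≤
      LinearMap.range (alpha (subPairing (omegaPreimage hH U.toSubmodule)) A))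
    (a : A) (z : H ⊗[R] H) {f : Module.Dual R H} (hf : f ∈ U.toSubmodule) :
    rconv (crossMap X (twistedComul R H) a z) f ∈
      LinearMap.range (alpha (subPairing U.toSubmodule) (A ⊗[R] H)) := by
  obtain ⟨t, ht⟩ := crossMap_twistedComul_mem hH hX a z
  rw [← ht]
  exact rconv_alpha_mem U t hf

end

/-! ### Comparison of the two actions on `A ⊗ H`. -/

section

variable {R : Type u} [CommRing R] {H : Type v} [Ring H] [HopfAlgebra R H]
variable {A : Type w} [Ring A] [Algebra R A]

open HopfAlgebra

/-- Left multiplication by `F` in the convolution algebra `Hom(H, B)`. -/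
def convLeft {B : Type*} [Ring B] [Algebra R B] (F : H →ₗ[R] B) :
    (H →ₗ[R] B) →ₗ[R] (H →ₗ[R] B) where
  toFun G := (toConv F * toConv G).ofConv
  map_add' G G' := congrArg ofConv (mul_add (toConv F) (toConv G) (toConv G'))
  map_smul' r G := congrArg ofConv (mul_smul_comm r (toConv F) (toConv G))

section convLeft

variable {B : Type*} [Ring B] [Algebra R B]

lemma convLeft_apply (F G : H →ₗ[R] B) (k : H) : convLeft F G k =
    LinearMap.mul' R B (TensorProduct.map F G (Coalgebra.comul k)) := rfl

lemma convLeft_injective {F F' : H →ₗ[R] B} (h : toConv F' * toConv F = 1) :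
    Function.Injective (convLeft F) := by
  intro G G' hG
  have h₁ : toConv F * toConv G = toConv F * toConv G' := congrArg toConv hG
  have h₂ := congrArg (toConv F' * ·) h₁
  simp only [← mul_assoc, h, one_mul] at h₂
  exact congrArg ofConv h₂

lemma convLeft_smulRight (F : H →ₗ[R] B) (f : Module.Dual R H) (b : B) :
    convLeft F (f.smulRight b) = rconv (LinearMap.mulRight R b ∘ₗ F) f := by
  ext k
  rw [convLeft_apply, rconv_apply]
  generalize (Coalgebra.comul k : H ⊗[R] H) = z
  induction z with
  | zero => simp
  | add x y hx hy => simp only [map_add, hx, hy]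
  | tmul x y => simp

end convLeft

variable (act : WeakAction R H A) (σ σ' : H ⊗[R] H →ₗ[R] A) (U : LeftModuleSubalgebra R H)

/-- The identity of `A ⊗ H` as a map from `A #_σ H`. -/
def CrossedProduct.toTensor : CrossedProduct act σ ≃ₗ[R] A ⊗[R] H := LinearEquiv.refl R (A ⊗[R] H)

/-- The map `x ↦ [k ↦ ∑ (1 # k₁) x(k₂)]` on `(A #_σ H) #ᵒᵖ U`, where `x` acts through `α`. -/
def crossedToHom [Fact (IsRightCrossedProduct act σ)] :
    SmashOp (CrossedProduct.coaction act σ) U →ₗ[R] (H →ₗ[R] A ⊗[R] H) :=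
  (CrossedProduct.toTensor act σ).congrRight.toLinearMap ∘ₗ
    convLeft (CrossedProduct.tmulHom act σ 1) ∘ₗ SmashOp.toHom (CrossedProduct.coaction act σ) U

variable (R H A) in
/-- The inclusion `H → A ⊗ H`. -/
def inclRight : H →ₐ[R] A ⊗[R] H := Algebra.TensorProduct.includeRight

variable (A) in
/-- The map `y ↦ [k ↦ ∑ (1 ⊗ k₁) y(k₂)]` on `(A ⊗ H) ⊗ U`, where `y` acts through `α`. -/
def tensorToHom : (A ⊗[R] H) ⊗[R] U.toSubmodule →ₗ[R] (H →ₗ[R] A ⊗[R] H) :=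
  convLeft (inclRight R H A).toLinearMap ∘ₗ alpha (subPairing U.toSubmodule) (A ⊗[R] H)

variable {act σ σ' U}

lemma tensorToHom_injective
    (hα : Function.Injective (alpha (subPairing U.toSubmodule) (A ⊗[R] H))) :
    Function.Injective (tensorToHom A U) :=
  (convLeft_injective (antipode_convMul_algHom (inclRight R H A))).comp hα

lemma alpha_tmul_eq_smulRight {M : Type*} [AddCommGroup M] [Module R M]
    (m : M) (f : U.toSubmodule) :
    alpha (subPairing U.toSubmodule) M (m ⊗ₜ f) = f.1.smulRight m := by
  ext k; simp [subPairing]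

open CrossedProduct

lemma tensorToHom_tmul (a : A) (h : H) (f : U.toSubmodule) :
    tensorToHom A U ((a ⊗ₜ h) ⊗ₜ f) =
      rconv (TensorProduct.mk R A H a ∘ₗ LinearMap.mulRight R h) f.1 := by
  refine (congrArg (convLeft (inclRight R H A).toLinearMap) (alpha_tmul_eq_smulRight _ f)).trans
    ((convLeft_smulRight _ _ _).trans ?_)
  refine congrArg (rconv · f.1) ?_
  ext k
  simp [inclRight]

variable (R H A U) in
/-- The action of `A ⊗ (H #ᵒᵖ U)` on `A ⊗ H` through right multiplication of `A` on itself and the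
action of `H #ᵒᵖ U` on `H`. -/
def tensorEnd : A ⊗[R] SmashOp (Coalgebra.comul : H →ₗ[R] H ⊗[R] H) U →ₗ[R]
    (A ⊗[R] H →ₗ[R] A ⊗[R] H) :=
  TensorProduct.homTensorHomMap (RingHom.id R) A H A H ∘ₗ
    TensorProduct.map (LinearMap.mul R A).flip (SmashOp.toEnd _ U)

@[simp] lemma tensorEnd_tmul_tmul (a b : A) (x : SmashOp (Coalgebra.comul : H →ₗ[R] H ⊗[R] H) U)
    (c : H) : tensorEnd R H A U (a ⊗ₜ x) (b ⊗ₜ c) = (b * a) ⊗ₜ SmashOp.toEnd _ U x c := rfl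

lemma tensorEnd_mul (x y : A ⊗[R] SmashOp (Coalgebra.comul : H →ₗ[R] H ⊗[R] H) U)
    (t : A ⊗[R] H) :
    tensorEnd R H A U (x * y) t = tensorEnd R H A U y (tensorEnd R H A U x t) := by
  induction x with
  | zero => simp
  | add x₁ x₂ h₁ h₂ => simp only [add_mul, map_add, LinearMap.add_apply, h₁, h₂]
  | tmul a x =>
    induction y with
    | zero => simp
    | add x₁ x₂ h₁ h₂ => simp only [mul_add, map_add, LinearMap.add_apply, h₁, h₂]
    | tmul b y =>
      induction t with
      | zero => simp
      | add x₁ x₂ h₁ h₂ => simp only [map_add, h₁, h₂]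
      | tmul c k =>
        rw [Algebra.TensorProduct.tmul_mul_tmul, tensorEnd_tmul_tmul, tensorEnd_tmul_tmul,
          tensorEnd_tmul_tmul, mul_assoc, SmashOp.toEnd_mul _ U mul_assoc
            (fun c => Coalgebra.coassoc_apply c) Bialgebra.comul_mul]

lemma tensorEnd_smul (x : A ⊗[R] SmashOp (Coalgebra.comul : H →ₗ[R] H ⊗[R] H) U) (a : A)
    (t : A ⊗[R] H) : tensorEnd R H A U x (a • t) = a • tensorEnd R H A U x t := by
  induction x with
  | zero => simp
  | add x₁ x₂ h₁ h₂ => simp only [map_add, LinearMap.add_apply, smul_add, h₁, h₂]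
  | tmul b x =>
    induction t with
    | zero => simp
    | add x₁ x₂ h₁ h₂ => simp only [map_add, smul_add, h₁, h₂]
    | tmul c k => simp [TensorProduct.smul_tmul', mul_assoc]

/-- Together with `tensorEnd_smul` this shows that an operator is determined by its `tensorToHom`,
which turns injectivity of that map into faithfulness of the action. -/
lemma tensorEnd_one_tmul (x : (A ⊗[R] H) ⊗[R] U.toSubmodule) (k : H) :
    tensorEnd R H A U (TensorProduct.assoc R A H U.toSubmodule x) (1 ⊗ₜ k) =
      tensorToHom A U x k := by
  induction x with
  | zero => simp; rfl
  | add x y hx hy =>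
    rw [map_add, map_add, LinearMap.add_apply, ← hx, ← hy]
    exact LinearMap.congr_fun (map_add (tensorEnd R H A U) _ _) _
  | tmul b f =>
    induction b with
    | zero => simp; rfl
    | add x y hx hy =>
      rw [TensorProduct.add_tmul, map_add, map_add, LinearMap.add_apply, ← hx, ← hy]
      exact LinearMap.congr_fun (map_add (tensorEnd R H A U) _ _) _
    | tmul a h =>
      rw [tensorToHom_tmul]
      change (1 * a) ⊗ₜ SmashOp.toEnd _ U (SmashOp.tmul _ U h f) k = _
      rw [SmashOp.toEnd_tmul, one_mul, rconv_apply]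
      generalize (Coalgebra.comul k : H ⊗[R] H) = z
      induction z with
      | zero => simp
      | add x y hx hy => simp only [map_add, add_mul, TensorProduct.tmul_add, hx, hy]
      | tmul x y => simp

lemma toEnd_smul (x : SmashOp (coaction act σ) U) (a : A) (c : CrossedProduct act σ) :
    SmashOp.toEnd _ U x (a • c) = a • SmashOp.toEnd _ U x c := by
  change LinearMap.mul' R _ (LinearMap.lTensor _ _ (coaction act σ (a • c))) =
    a • LinearMap.mul' R _ (LinearMap.lTensor _ _ (coaction act σ c))
  rw [coaction_smul]
  generalize coaction act σ c = z
  induction z with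
  | zero => simp
  | add x y hx hy => simp only [map_add, smul_add, hx, hy]
  | tmul x y => rw [TensorProduct.smul_tmul']; simp [smul_mul]

variable [Fact (IsRightCrossedProduct act σ)]

lemma crossedToHom_injective (hσ' : IsConvInverse σ σ')
    (hα : Function.Injective (alpha (subPairing U.toSubmodule) (A ⊗[R] H))) :
    Function.Injective (crossedToHom act σ U) :=
  (toTensor act σ).congrRight.injective.comp
    ((convLeft_injective (isCrossed.inverse_mul hσ')).comp hα)

lemma toHom_tmul_eq_smulRight (b : CrossedProduct act σ) (f : U.toSubmodule) :
    SmashOp.toHom (coaction act σ) U (SmashOp.tmul _ U b f) = f.1.smulRight b := by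
  ext k; exact SmashOp.toHom_tmul _ U b f k

lemma crossedToHom_tmul (a : A) (h : H) (f : U.toSubmodule) :
    crossedToHom act σ U (SmashOp.tmul _ U (CrossedProduct.tmul act σ a h) f) =
      rconv (crossMap (phi act σ) Coalgebra.comul a (Coalgebra.comul h)) f.1 := by
  change (toTensor act σ).toLinearMap ∘ₗ convLeft (tmulHom act σ 1)
    (SmashOp.toHom (coaction act σ) U (SmashOp.tmul _ U (CrossedProduct.tmul act σ a h) f)) = _
  rw [toHom_tmul_eq_smulRight, convLeft_smulRight, comp_rconv]
  refine congrArg (rconv · f.1) ?_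
  ext k
  exact one_tmul_mul_tmul_eq_crossMap_phi a h k

/-- On generators the map is `k ↦ ∑ φ(h₁ ⊗ a)(k₁) ⊗ k₂ h₂`, convolved with `f`. Pulling out the
inclusion of `H` leaves its twisted form, which the hypothesis on `φ` places in the image of `α`. -/
lemma range_crossedToHom_le (hH : LocallyProjective R H)
    (hφ : LinearMap.range (phi act σ) ≤
      LinearMap.range (alpha (subPairing (omegaPreimage hH U.toSubmodule)) A)) :
    LinearMap.range (crossedToHom act σ U) ≤ LinearMap.range (tensorToHom A U) := by
  rintro _ ⟨x, rfl⟩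
  induction x using SmashOp.induction_on with
  | zero => rw [map_zero]; exact zero_mem _
  | add x y hx hy => rw [map_add]; exact add_mem hx hy
  | tmul b f =>
    induction b using CrossedProduct.induction_on with
    | zero =>
      have : SmashOp.tmul (coaction act σ) U 0 f = 0 := TensorProduct.zero_tmul _ _
      rw [this, map_zero]; exact zero_mem _
    | add x y hx hy =>
      have : SmashOp.tmul (coaction act σ) U (x + y) f =
        SmashOp.tmul _ U x f + SmashOp.tmul _ U y f := TensorProduct.add_tmul _ _ _
      rw [this, map_add]; exact add_mem hx hy
    | tmul a h =>
      obtain ⟨y, hy⟩ := rconv_crossMap_twistedComul_mem hH U hφ a (Coalgebra.comul h) f.2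
      refine ⟨y, ?_⟩
      rw [crossedToHom_tmul, tensorToHom, LinearMap.comp_apply, hy]
      have h₁ := mul_rconv (toConv (inclRight R H A).toLinearMap)
        (crossMap (phi act σ) (twistedComul R H) a (Coalgebra.comul h)) f.1
      rw [inclRight, includeRight_mul_crossMap] at h₁
      exact congrArg ofConv h₁

lemma range_tensorToHom_le (hH : LocallyProjective R H) (hσ' : IsConvInverse σ σ')
    (hψ : LinearMap.range (psi act σ σ') ≤
      LinearMap.range (alpha (subPairing (omegaPreimage hH U.toSubmodule)) A)) :
    LinearMap.range (tensorToHom A U) ≤ LinearMap.range (crossedToHom act σ U) := by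
  rintro _ ⟨y, rfl⟩
  induction y with
  | zero => rw [map_zero]; exact zero_mem _
  | add x y hx hy => rw [map_add]; exact add_mem hx hy
  | tmul b f =>
    induction b with
    | zero => rw [TensorProduct.zero_tmul, map_zero]; exact zero_mem _
    | add x y hx hy => rw [TensorProduct.add_tmul, map_add]; exact add_mem hx hy
    | tmul a h =>
      -- The preimage supplied by the hypothesis on `ψ` lies in `(A ⊗ H) ⊗ U`; it is reread as an
      -- element of the smash product, which has the same underlying module.
      obtain ⟨(x : SmashOp (coaction act σ) U), hx⟩ :=
        rconv_crossMap_twistedComul_mem hH U hψ a (Coalgebra.comul h) f.2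
      refine ⟨x, ?_⟩
      rw [tensorToHom_tmul]
      let j' := IsCrossed.inverse σ' (incl act σ) (tmulHom act σ 1)
      let G : H →ₗ[R] CrossedProduct act σ := tmulHom act σ a ∘ₗ LinearMap.mulRight R h
      have h₁ : (toTensor act σ).toLinearMap ∘ₗ (toConv j' * toConv G).ofConv =
          crossMap (psi act σ σ') (twistedComul R H) a (Coalgebra.comul h) := by
        ext k
        exact inverse_mul_tmulHom_comp_mulRight a h k
      have h₂ : toConv (SmashOp.toHom (coaction act σ) U x) = toConv j' * toConv (rconv G f.1) := by
        rw [mul_rconv]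
        refine congrArg toConv ((toTensor act σ).congrRight.injective ?_)
        refine Eq.trans hx ?_
        change _ = (toTensor act σ).toLinearMap ∘ₗ rconv _ _
        rw [comp_rconv, h₁]
      -- This is where `j` must be cancelled against its inverse in the order `j ⋆ j⁻¹`; injectivity
      -- used only `j⁻¹ ⋆ j`.
      have h₃ : toConv (tmulHom act σ 1) * toConv (SmashOp.toHom (coaction act σ) U x) =
          toConv (rconv G f.1) := by
        rw [h₂, ← mul_assoc, isCrossed.mul_inverse hσ', one_mul]
      refine (congrArg (fun F => (toTensor act σ).toLinearMap ∘ₗ ofConv F) h₃).trans ?_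
      exact comp_rconv _ _ _

lemma toEnd_one_tmul (x : SmashOp (coaction act σ) U) (k : H) :
    SmashOp.toEnd _ U x (CrossedProduct.tmul act σ 1 k) = (toTensor act σ).symm (crossedToHom act σ U x k) := by
  change LinearMap.mul' R _ (LinearMap.lTensor _ _ (coaction act σ (CrossedProduct.tmul act σ 1 k)))
    = LinearMap.mul' R _ (TensorProduct.map _ _ (Coalgebra.comul (R := R) k))
  rw [coaction_tmul, ← LinearMap.comp_apply (LinearMap.lTensor _ _), LinearMap.lTensor_comp_rTensor]

end

end KoppinenDuality

end

/-! ### The isomorphism. -/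

open KoppinenDuality in
theorem mainTheorem4
    {R : Type u} [CommRing R]
    {H : Type v} [Ring H] [HopfAlgebra R H] (hH : LocallyProjective R H)
    {A : Type w} [Ring A] [Algebra R A]
    -- a right `H`-crossed product `A #_σ H` with invertible cocycle, `σ' = σ⁻¹`
    (act : WeakAction R H A) (σ σ' : H ⊗[R] H →ₗ[R] A)
    (hσ : IsRightCrossedProduct act σ) (hσ' : IsConvInverse σ σ')
    (U : LeftModuleSubalgebra R H)
    -- `φ(H ⊗ A), ψ(H ⊗ A) ⊆ J(A ⊗ ω⁻¹(H ⊗ U))`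
    (hφ : LinearMap.range (phi act σ) ≤
      LinearMap.range (alpha (subPairing (omegaPreimage hH U.toSubmodule)) A))
    (hψ : LinearMap.range (psi act σ σ') ≤
      LinearMap.range (alpha (subPairing (omegaPreimage hH U.toSubmodule)) A)) :
    -- if `α_{A ⊗ H}` is injective, the two algebras are isomorphic
    (Function.Injective (alpha (subPairing U.toSubmodule) (A ⊗[R] H)) →
      ∃ e : SmashOp (CrossedProduct.coaction act σ) U ≃ₗ[R]
          A ⊗[R] SmashOp (Coalgebra.comul : H →ₗ[R] H ⊗[R] H) U,
        (∀ x y, e (x * y) = e x * e y) ∧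
        ∀ hε : Coalgebra.counit ∈ U.toSubmodule,
          e (SmashOp.tmul _ U (CrossedProduct.tmul act σ 1 1) ⟨Coalgebra.counit, hε⟩) =
            1 ⊗ₜ[R] SmashOp.tmul _ U 1 ⟨Coalgebra.counit, hε⟩) ∧
    -- which is the case if `R` is Noetherian and `U ⊆ R^H` is `A`-pure
    (IsNoetherianRing R → IsPureFor (U.toSubmodule.map (LinearMap.ltoFun R H R R)) A →
      Function.Injective (alpha (subPairing U.toSubmodule) (A ⊗[R] H))) := by
  refine ⟨fun hα => ?_, fun _ hU => ?_⟩
  swap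
  · have h₁ := alpha_injective_of_isPureFor (N := A) U.toSubmodule hU
    have h₂ := LocallyProjective.alpha_tensor_injective (V := H) (K := U.toSubmodule) (N := A) hH
      (subPairing U.toSubmodule)
    exact h₂ h₁
  have : Fact (IsRightCrossedProduct act σ) := ⟨hσ⟩
  have hL := crossedToHom_injective (act := act) hσ' hα
  have hL' := tensorToHom_injective (A := A) hα
  have hrange : LinearMap.range (crossedToHom act σ U) = LinearMap.range (tensorToHom A U) :=
    le_antisymm (range_crossedToHom_le hH hφ) (range_tensorToHom_le hH hσ' hψ)
  -- Two injective maps into `Hom(H, A ⊗ H)` with equal images.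
  let e₀ : SmashOp (CrossedProduct.coaction act σ) U ≃ₗ[R] (A ⊗[R] H) ⊗[R] U.toSubmodule :=
    (LinearEquiv.ofInjective _ hL).trans
      ((LinearEquiv.ofEq _ _ hrange).trans (LinearEquiv.ofInjective _ hL').symm)
  have he₀ : ∀ x, tensorToHom A U (e₀ x) = crossedToHom act σ U x := fun x =>
    congrArg Subtype.val (LinearEquiv.apply_symm_apply (LinearEquiv.ofInjective _ hL') _)
  let e : SmashOp (CrossedProduct.coaction act σ) U ≃ₗ[R]
      A ⊗[R] SmashOp (Coalgebra.comul : H →ₗ[R] H ⊗[R] H) U :=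
    e₀.trans (TensorProduct.assoc R A H U.toSubmodule)
  -- The defining property of `e₀` concerns only the elements `1 # k`; left `A`-linearity of both
  -- actions extends it to all of `A ⊗ H`.
  have he : ∀ x c, SmashOp.toEnd _ U x c = (tensorEnd R H A U (e x) c : A ⊗[R] H) := by
    intro x c
    induction c using CrossedProduct.induction_on with
    | zero => rw [map_zero]; exact (map_zero (tensorEnd R H A U (e x))).symm
    | add c d hc hd =>
      rw [map_add, hc, hd]; exact (map_add (tensorEnd R H A U (e x)) c d).symm
    | tmul a k =>
      rw [CrossedProduct.tmul_eq_smul, toEnd_smul, toEnd_one_tmul, ← he₀]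
      refine Eq.trans ?_ (tensorEnd_smul (e x) a (1 ⊗ₜ k)).symm
      exact congrArg (a • ·) (tensorEnd_one_tmul (e₀ x) k).symm
  have hinj : ∀ y z : A ⊗[R] SmashOp (Coalgebra.comul : H →ₗ[R] H ⊗[R] H) U,
      (∀ k, tensorEnd R H A U y (1 ⊗ₜ k) = tensorEnd R H A U z (1 ⊗ₜ k)) → y = z := by
    intro y z hyz
    obtain ⟨y, rfl⟩ := (TensorProduct.assoc R A H U.toSubmodule).surjective y
    obtain ⟨z, rfl⟩ := (TensorProduct.assoc R A H U.toSubmodule).surjective z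
    refine congrArg (TensorProduct.assoc R A H U.toSubmodule) (hL' ?_)
    ext k
    rw [← tensorEnd_one_tmul, ← tensorEnd_one_tmul]
    exact hyz k
  refine ⟨e, fun x y => hinj _ _ fun k => ?_, fun hε => hinj _ _ fun k => ?_⟩
  · rw [tensorEnd_mul]
    refine (he (x * y) (CrossedProduct.tmul act σ 1 k)).symm.trans ?_
    -- Both actions are right actions, so `x * y` and `e x * e y` give the same operator, and
    -- faithfulness concludes.
    rw [SmashOp.toEnd_mul _ U hσ.mul_assoc CrossedProduct.coaction_coassoc
      CrossedProduct.coaction_mul, he, he]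
    rfl
  -- Both elements fix `1 ⊗ k`, by the counit axiom.
  · refine (he _ (CrossedProduct.tmul act σ 1 k)).symm.trans ?_
    rw [SmashOp.toEnd_tmul, tensorEnd_tmul_tmul, SmashOp.toEnd_tmul, one_mul, mul_one,
      hσ.mul_one, CrossedProduct.coaction_tmul, ← LinearMap.comp_apply (LinearMap.lTensor _ _),
      LinearMap.lTensor_comp_rTensor, Coalgebra.lTensor_counit_comul, TensorProduct.rid_tmul,
      one_smul, ← LinearMap.rTensor_comp_lTensor, LinearMap.comp_apply,
      Coalgebra.lTensor_counit_comul]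
    simp
    rfl
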